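/- Let $M$ be an $n$-dimensional smooth manifold, $\mathcal TM = TM\setminus\{0\}$ its slit tangent bundle, $J$ the vertical endomorphism and $C$ the Liouville vector field on $TM$ (locally $J = dx^i\otimes\frac{\partial}{\partial y^i}$, $C = y^i\frac{\partial}{\partial y^i}$). Let $S$ be a spray on $M$, that is, a smooth vector field on $\mathcal TM$ with $JS=C$ and $[C,S]=S$. Let $\Gamma=[J,S]$ be its nonlinear connection (Frölicher–Nijenhuis bracket, $[J,S](Y)=[JY,S]-J[Y,S]$), $h=\frac12(\mathrm{Id}+\Gamma)$ the horizontal projector and $R=\frac12[h,h]$ the curvature. For a function $F$ put $d_JF(X)=(JX)F$, and let $i_\Gamma$, $i_R$ be the derivations $$ (i_\Gamma\omega)(X,Y)=\omega(\Gamma X,Y)+\omega(X,\Gamma Y),\qquad (i_R\omega)(X,Y,Z)=\omega(R(X,Y),Z)+\omega(R(Y,Z),X)+\omega(R(Z,X),Y) $$ on $2$-forms. The extended Rapcsák system is $P_2=(P_\Gamma,P_C)$ with $$ P_\Gamma F = i_\Gamma dd_JF,\qquad P_C F=\mathcal L_CF-F . $$ For $x\in\mathcal TM$ and $k\ge 2$,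 a $k$-th order (formal) solution of $P_2$ at $x$ is a $k$-jet $j_k(F)_x$ of a smooth function $F$ defined near $x$ such that $j_{k-2}(P_\Gamma F)_x=0$ and $j_{k-1}(P_CF)_x=0$. **Proposition.** Let $x\in\mathcal TM$ and let $s=j_2(F)_x$ be a second-order solution of $P_2$ at $x$. Then $s$ can be prolonged to a third-order solution at $x$ (there is a third-order solution of $P_2$ at $x$ whose image under the natural projection of $3$-jets to $2$-jets is $s$) if and only if $(i_R\,dd_JF)_x=0$. -/

import Mathlib

open scoped Manifold ContDiff Topology

noncomputable section

namespace Rapcsak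

/-- The model space of the base manifold. -/
abbrev E (n : ℕ) := EuclideanSpace ℝ (Fin n)

/-- The tangent manifold `TM` of an `n`-dimensional manifold `M`. -/
abbrev TM (n : ℕ) (M : Type*) [TopologicalSpace M] [ChartedSpace (E n) M]
    [IsManifold (𝓡 n) ∞ M] :=
  TangentBundle (𝓡 n) M

/-- Vector fields on `TM` (not necessarily smooth, defined everywhere). -/
abbrev VField (n : ℕ) (M : Type*) [TopologicalSpace M] [ChartedSpace (E n) M]
    [IsManifold (𝓡 n) ∞ M] :=
  (p : TM n M) → TangentSpace (𝓡 n).tangent p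

section

variable {n : ℕ} {M : Type*} [TopologicalSpace M] [ChartedSpace (E n) M]
  [IsManifold (𝓡 n) ∞ M]

/-- The slit tangent space: `TM` without the zero section. -/
def slit (n : ℕ) (M : Type*) [TopologicalSpace M] [ChartedSpace (E n) M]
    [IsManifold (𝓡 n) ∞ M] : Set (TM n M) :=
  {p | p.2 ≠ 0}

/-- The function `F` is smooth on a neighbourhood of `x`. -/
def SmoothFnNear (F : TM n M → ℝ) (x : TM n M) : Prop :=
  ∀ᶠ q in 𝓝 x, ContMDiffAt (𝓡 n).tangent 𝓘(ℝ, ℝ) ∞ F q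

/-- The vector field `X` on `TM`, as a section of `TTM`. -/
def toSection (X : VField n M) (q : TM n M) : TangentBundle (𝓡 n).tangent (TM n M) :=
  ⟨q, X q⟩

/-- The vector field `X` is smooth on a neighbourhood of `x`. -/
def SmoothVFNear (X : VField n M) (x : TM n M) : Prop :=
  ∀ᶠ q in 𝓝 x, ContMDiffAt (𝓡 n).tangent (𝓡 n).tangent.tangent ∞ (toSection X) q

/-! ### Vertical endomorphism, Liouville field, sprays -/

/-- The vertical lift to `T_p TM` of a vector `w` tangent to `M` at the foot of `p`:
the derivative of the inclusion of the fibre in `TM`, applied to `w`. -/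
def verticalLift (p : TM n M) (w : E n) : TangentSpace (𝓡 n).tangent p :=
  mfderiv 𝓘(ℝ, E n) (𝓡 n).tangent (fun u : E n => (⟨p.1, u⟩ : TM n M)) p.2 w

/-- The Liouville vector field `C = y^i ∂/∂y^i`. -/
def C : VField n M := fun p => verticalLift p p.2

/-- The vertical endomorphism `J = dx^i ⊗ ∂/∂y^i`: project to `TM`, then lift vertically. -/
def J (X : VField n M) : VField n M := fun p =>
  verticalLift p
    (mfderiv (𝓡 n).tangent (𝓡 n) (fun q : TM n M => q.1) p (X p))

/-- The Lie bracket of vector fields on `TM`. -/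
def bracket (X Y : VField n M) : VField n M :=
  VectorField.mlieBracket (𝓡 n).tangent X Y

/-- A spray: a vector field, smooth on the slit tangent space, such that `J S = C` and
`[C, S] = S` there. (The values of `S` on the zero section are irrelevant.) -/
structure IsSpray (S : VField n M) : Prop where
  smooth : ContMDiffOn (𝓡 n).tangent (𝓡 n).tangent.tangent ∞ (toSection S) (slit n M)
  J_eq : ∀ p ∈ slit n M, J S p = C p
  bracket_eq : ∀ p ∈ slit n M, bracket C S p = S p

/-! ### Forms and vector valued forms, given by their values on vector fields -/

/-- A vector valued one-form as an operator on vector fields. -/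
abbrev VecForm1 (n : ℕ) (M : Type*) [TopologicalSpace M] [ChartedSpace (E n) M]
    [IsManifold (𝓡 n) ∞ M] :=
  VField n M → VField n M

/-- A vector valued two-form as an operator on pairs of vector fields. -/
abbrev VecForm2 (n : ℕ) (M : Type*) [TopologicalSpace M] [ChartedSpace (E n) M]
    [IsManifold (𝓡 n) ∞ M] :=
  VField n M → VField n M → VField n M

/-- Scalar one-forms (below: two- and three-forms), as functions of vector fields. -/
abbrev Form1 (n : ℕ) (M : Type*) [TopologicalSpace M] [ChartedSpace (E n) M]
    [IsManifold (𝓡 n) ∞ M] :=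
  VField n M → TM n M → ℝ

/-- Scalar forms, see `Form1`. -/
abbrev Form2 (n : ℕ) (M : Type*) [TopologicalSpace M] [ChartedSpace (E n) M]
    [IsManifold (𝓡 n) ∞ M] :=
  VField n M → VField n M → TM n M → ℝ

/-- Scalar forms, see `Form1`. -/
abbrev Form3 (n : ℕ) (M : Type*) [TopologicalSpace M] [ChartedSpace (E n) M]
    [IsManifold (𝓡 n) ∞ M] :=
  VField n M → VField n M → VField n M → TM n M → ℝ

/-- The derivative `X F = dF(X)` of a function along a vector field. -/
def lieD (X : VField n M) (F : TM n M → ℝ) : TM n M → ℝ := fun p =>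
  mfderiv (𝓡 n).tangent 𝓘(ℝ, ℝ) F p (X p)

/-- The exterior derivative of a one-form,
`dα(X, Y) = X(α(Y)) - Y(α(X)) - α([X, Y])`. -/
def extD (α : Form1 n M) : Form2 n M := fun X Y =>
  lieD X (α Y) - lieD Y (α X) - α (bracket X Y)

/-- For a function `F` and a vector valued one-form `K`, the one-form
`d_K F = i_K dF`, that is `(d_K F)(X) = (K X) F`. -/
def dAlong (K : VecForm1 n M) (F : TM n M → ℝ) : Form1 n M := fun X => lieD (K X) F

/-- The derivation `i_K` for a vector valued one-form `K`, on two-forms. -/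
def ins1 (K : VecForm1 n M) (θ : Form2 n M) : Form2 n M := fun X Y =>
  θ (K X) Y + θ X (K Y)

/-- The derivation `i_R` for a vector valued two-form `R`, on two-forms. -/
def ins2 (R : VecForm2 n M) (θ : Form2 n M) : Form3 n M := fun X Y Z =>
  θ (R X Y) Z + θ (R Y Z) X + θ (R Z X) Y

/-- The Frölicher–Nijenhuis bracket of a vector valued one-form and a vector field,
`[K, X](Y) = [K Y, X] - K [Y, X]`. -/
def fnBracketVF (K : VecForm1 n M) (X : VField n M) : VecForm1 n M := fun Y =>
  bracket (K Y) X - K (bracket Y X)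

/-- The Frölicher–Nijenhuis bracket of two vector valued one-forms. -/
def fnBracket (K L : VecForm1 n M) : VecForm2 n M := fun X Y =>
  bracket (K X) (L Y) + bracket (L X) (K Y)
    + K (L (bracket X Y)) + L (K (bracket X Y))
    - K (bracket (L X) Y) - K (bracket X (L Y))
    - L (bracket (K X) Y) - L (bracket X (K Y))

/-- The nonlinear connection `Γ = [J, S]` of `S`. -/
def connection (S : VField n M) : VecForm1 n M := fnBracketVF J S

/-- The horizontal projector `h = (Id + Γ) / 2`. -/
def horizontal (S : VField n M) : VecForm1 n M := fun X =>
  (1 / 2 : ℝ) • (X + connection S X)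

/-- The curvature `R = [h, h] / 2` of the connection. -/
def curvature (S : VField n M) : VecForm2 n M := fun X Y =>
  (1 / 2 : ℝ) • fnBracket (horizontal S) (horizontal S) X Y

/-- The two-form `dd_J F`. -/
def ddJ (F : TM n M → ℝ) : Form2 n M := extD (dAlong J F)

/-- The operator `P_Γ F = i_Γ dd_J F`. -/
def PGamma (S : VField n M) (F : TM n M → ℝ) : Form2 n M :=
  ins1 (connection S) (ddJ F)

/-- The operator `P_C F = 𝓛_C F - F`. -/
def PC (F : TM n M → ℝ) : TM n M → ℝ := lieD C F - F

/-- The three-form vanishes at the point `x`. -/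
def vanishesAt (θ : Form3 n M) (x : TM n M) : Prop :=
  ∀ X Y Z : VField n M, SmoothVFNear X x → SmoothVFNear Y x → SmoothVFNear Z x →
    θ X Y Z x = 0

/-! ### Jets and formal solutions -/

/-- Coordinates of `k`-jets of functions on `TM`: one multilinear form on the model space
of `TM` for each order `i ≤ k`. -/
abbrev JetCoord (n k : ℕ) :=
  (i : Fin (k + 1)) → ContinuousMultilinearMap ℝ (fun _ : Fin i => E n × E n) ℝ

/-- The jet `j_k(F)_x`, in the preferred chart of `TM` at `x`: the derivatives of `F` of
order at most `k` at `x`. -/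
def jet (k : ℕ) (F : TM n M → ℝ) (x : TM n M) : JetCoord n k := fun i =>
  iteratedFDeriv ℝ i (F ∘ (extChartAt (𝓡 n).tangent x).symm)
    (extChartAt (𝓡 n).tangent x x)

/-- The natural projection from `(k+1)`-jets to `k`-jets. -/
def jetProj {k : ℕ} (s : JetCoord n (k + 1)) : JetCoord n k := fun i => s i.castSucc

/-- The `l`-jet at `x` of the two-form `θ` is zero: its values on smooth vector fields have
zero `l`-jet at `x`. -/
def jetVanishes (l : ℕ) (θ : Form2 n M) (x : TM n M) : Prop :=
  ∀ X Y : VField n M, SmoothVFNear X x → SmoothVFNear Y x → jet l (θ X Y) x = 0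

/-- The formal solutions of order `l + 2` at `x` of the extended Rapcsák system
`P₂ = (P_Γ, P_C)`: the kernel, in the space of `(l+2)`-jets at `x`, of
`j_{l+2}(F) ↦ (j_l(P_Γ F), j_{l+1}(P_C F))`. -/
def Sol (S : VField n M) (l : ℕ) (x : TM n M) : Set (JetCoord n (l + 2)) :=
  {s | ∃ F : TM n M → ℝ, SmoothFnNear F x ∧ jet (l + 2) F x = s ∧
    jetVanishes l (PGamma S F) x ∧ jet (l + 1) (PC F) x = 0}

end

end Rapcsak

end

noncomputable section
namespace Rapcsak
open VectorField

/-! ### Coordinate expressions of fields and functions in a chart of `TM` -/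

section Charts

variable {n : ℕ} {M : Type*} [TopologicalSpace M] [ChartedSpace (E n) M]
  [IsManifold (𝓡 n) ∞ M]

/-! In a chart z = (x, y) of `TM` the spray is (y, s) with s homogeneous of degree two in y, and
both sides of the equivalence become conditions on the derivatives of F at one point. With the
horizontal lift hu = (u, ½ ∂_u s), where ∂_u is the derivative in the fibre direction u, the
coefficients of P_Γ F are, up to a factor 2, D²F(hu, v) − D²F(hv, u), where v stands for (0, v).
Differentiating them along w gives `gammaDeriv`.

Necessity: in the cyclic sum of these derivatives over horizontal directions the third derivatives
of F cancel by symmetry, and what is left is exactly i_R dd_J F (`gammaDeriv_horizontal_cyclic`). A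
third-order solution makes the derivatives vanish, and i_R dd_J F sees only the 2-jet.

Sufficiency: a cubic term with symmetric third derivative T is added to a representative of the
2-jet. This requires prescribed values of T(w, hu, v) − T(w, hv, u) and of T(a, b, C). The data must
satisfy three compatibility conditions: the vertical cyclic sum vanishes
(`gammaDeriv_vertical_cyclic`, automatic), the horizontal cyclic sum vanishes (the hypothesis on i_R
dd_J F), and the derivative of P_Γ F along C agrees with P_Γ applied to P_C F
(`gammaDeriv_liouville`, a consequence of homogeneity). The linear algebra showing that these
suffice, for y ≠ 0, is `exists_symm_trilinear`; `exists_prolongation` applies it. -/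

instance isManifold_TM : IsManifold (𝓡 n).tangent ∞ (TM n M) := by
  -- The tangent bundle loses one degree of smoothness, which is harmless because ∞ + 1 = ∞.
  have : IsManifold (𝓡 n) (∞ + 1) M := ‹IsManifold (𝓡 n) ∞ M›
  have := TangentBundle.contMDiffVectorBundle (n := ∞) (I := 𝓡 n) (M := M)
  infer_instance

/-- The function `f` on the model space is smooth on a neighbourhood of `z₀`. -/
def SmoothNear {n : ℕ} {G : Type*} [NormedAddCommGroup G] [NormedSpace ℝ G]
    (f : E n × E n → G) (z₀ : E n × E n) : Prop :=
  ∀ᶠ z in 𝓝 z₀, ContDiffAt ℝ ∞ f z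

/-- The preferred chart of `TM` at `x`. -/
abbrev chart (x : TM n M) : PartialEquiv (TM n M) (E n × E n) :=
  extChartAt (𝓡 n).tangent x

/-- The derivative at `q` of the preferred chart at `x`. -/
def chartD (x q : TM n M) : TangentSpace (𝓡 n).tangent q →L[ℝ] E n × E n :=
  mfderiv (𝓡 n).tangent 𝓘(ℝ, E n × E n) (chart x) q

/-- The vector field `X` has the coordinate expression `Xc` near `x`. -/
def Rep (x : TM n M) (X : VField n M) (Xc : E n × E n → E n × E n) : Prop :=
  SmoothNear Xc (chart x x) ∧ ∀ᶠ q in 𝓝 x, chartD x q (X q) = Xc (chart x q)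

/-- The function `F` has the coordinate expression `Fc` near `x`. -/
def RepFn (x : TM n M) (F : TM n M → ℝ) (Fc : E n × E n → ℝ) : Prop :=
  SmoothNear Fc (chart x x) ∧ ∀ᶠ q in 𝓝 x, F q = Fc (chart x q)

variable {x : TM n M} {X Y : VField n M} {Xc Yc : E n × E n → E n × E n}
  {F F' : TM n M → ℝ} {Fc Fc' : E n × E n → ℝ}

lemma chart_source_mem (x : TM n M) : (chart x).source ∈ 𝓝 x := extChartAt_source_mem_nhds x

lemma isOpen_chart_target (x : TM n M) : IsOpen (chart x).target := isOpen_extChartAt_target x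

lemma chart_target_mem (x : TM n M) : (chart x).target ∈ 𝓝 (chart x x) :=
  extChartAt_target_mem_nhds x

lemma chart_tendsto (x : TM n M) : Filter.Tendsto (chart x) (𝓝 x) (𝓝 (chart x x)) :=
  continuousAt_extChartAt x

lemma chart_symm_tendsto (x : TM n M) :
    Filter.Tendsto (chart x).symm (𝓝 (chart x x)) (𝓝 x) := by
  have := continuousAt_extChartAt_symm (I := (𝓡 n).tangent) x
  rwa [ContinuousAt, extChartAt_to_inv] at this

lemma chart_contMDiffAt {x q : TM n M} (hq : q ∈ (chart x).source) :
    ContMDiffAt (𝓡 n).tangent 𝓘(ℝ, E n × E n) ∞ (chart x) q :=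
  contMDiffAt_extChartAt' (by rwa [extChartAt_source] at hq)

lemma chart_symm_contMDiffAt {x : TM n M} {z : E n × E n} (hz : z ∈ (chart x).target) :
    ContMDiffAt 𝓘(ℝ, E n × E n) (𝓡 n).tangent ∞ (chart x).symm z :=
  (contMDiffOn_extChartAt_symm x).contMDiffAt ((isOpen_chart_target x).mem_nhds hz)

lemma chartD_isInvertible {x q : TM n M} (hq : q ∈ (chart x).source) :
    (chartD x q).IsInvertible :=
  isInvertible_mfderiv_extChartAt hq

lemma chartD_injective {x q : TM n M} (hq : q ∈ (chart x).source) :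
    Function.Injective (chartD x q) :=
  (chartD_isInvertible hq).injective

lemma chartD_mpullback {x q : TM n M} (hq : q ∈ (chart x).source)
    (V : E n × E n → E n × E n) :
    chartD x q (mpullback (𝓡 n).tangent 𝓘(ℝ, E n × E n) (chart x) V q) = V (chart x q) :=
  (chartD_isInvertible hq).self_apply_inverse _

lemma Rep.eventuallyEq (h : Rep x X Xc) :
    X =ᶠ[𝓝 x] mpullback (𝓡 n).tangent 𝓘(ℝ, E n × E n) (chart x) Xc := by
  filter_upwards [h.2, chart_source_mem x] with q h1 hq
  exact chartD_injective hq (h1.trans (chartD_mpullback hq Xc).symm)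

lemma smoothVFNear_of_rep (h : Rep x X Xc) : SmoothVFNear X x := by
  have h1 := (chart_tendsto x).eventually h.1
  have h2 := h.eventuallyEq.eventually_nhds
  filter_upwards [h1, h2, chart_source_mem x] with q h1 h2 hq
  have : ContMDiffAt (𝓡 n).tangent (𝓡 n).tangent.tangent ∞
      (fun q => (⟨q, mpullback (𝓡 n).tangent 𝓘(ℝ, E n × E n) (chart x) Xc q⟩ :
        TangentBundle (𝓡 n).tangent (TM n M))) q :=
    ContMDiffAt.mpullback_vectorField_preimage
      (contMDiffAt_vectorSpace_iff_contDiffAt.2 h1) (chart_contMDiffAt hq)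
      (chartD_isInvertible hq) le_rfl
  refine this.congr_of_eventuallyEq ?_
  filter_upwards [h2] with p hp
  rw [toSection, hp]

lemma exists_rep_of_coord (x : TM n M) (h : SmoothNear Xc (chart x x)) :
    ∃ X : VField n M, SmoothVFNear X x ∧ Rep x X Xc := by
  have : Rep x (mpullback (𝓡 n).tangent 𝓘(ℝ, E n × E n) (chart x) Xc) Xc := by
    refine ⟨h, ?_⟩
    filter_upwards [chart_source_mem x] with q hq
    exact chartD_mpullback hq Xc
  exact ⟨_, smoothVFNear_of_rep this, this⟩

lemma exists_rep (h : SmoothVFNear X x) : ∃ Xc, Rep x X Xc := by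
  let Xc : E n × E n → E n × E n :=
    mpullback 𝓘(ℝ, E n × E n) (𝓡 n).tangent (chart x).symm X
  refine ⟨Xc, ?_, ?_⟩
  · filter_upwards [(chart_symm_tendsto x).eventually h, chart_target_mem x] with z h1 hz
    have hinv : (mfderiv 𝓘(ℝ, E n × E n) (𝓡 n).tangent (chart x).symm z).IsInvertible := by
      have := isInvertible_mfderivWithin_extChartAt_symm (I := (𝓡 n).tangent) (x := x) hz
      rwa [ModelWithCorners.Boundaryless.range_eq_univ, mfderivWithin_univ] at this
    exact contMDiffAt_vectorSpace_iff_contDiffAt.1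
      (ContMDiffAt.mpullback_vectorField_preimage h1 (chart_symm_contMDiffAt hz) hinv le_rfl)
  · have := eventuallyEq_mpullback_mpullbackWithin_extChartAt (s := Set.univ)
      (I := (𝓡 n).tangent) (x := x) X
    rw [nhdsWithin_univ, ModelWithCorners.Boundaryless.range_eq_univ, mpullbackWithin_univ] at this
    filter_upwards [this, chart_source_mem x] with q h1 hq
    rw [h1]
    exact chartD_mpullback hq Xc

lemma mlieBracket_modelSpace {G : Type*} [NormedAddCommGroup G] [NormedSpace ℝ G]
    (V W : (z : G) → TangentSpace 𝓘(ℝ, G) z) :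
    mlieBracket 𝓘(ℝ, G) V W = lieBracket ℝ V W := by
  rw [← mlieBracketWithin_univ, mlieBracketWithin_eq_lieBracketWithin]
  exact lieBracketWithin_univ

/-- Near x the fields are pullbacks of their coordinate expressions by the chart, and the Lie
bracket commutes with pullback. -/
lemma Rep.bracket (hX : Rep x X Xc) (hY : Rep x Y Yc) :
    Rep x (bracket X Y) (lieBracket ℝ Xc Yc) := by
  constructor
  · filter_upwards [hX.1, hY.1] with z h1 h2
    simp only [lieBracket_eq]
    exact (((h2.fderiv_right (m := ∞) le_rfl).clm_apply h1).sub
      ((h1.fderiv_right (m := ∞) le_rfl).clm_apply h2))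
  · have hb : Rapcsak.bracket X Y =ᶠ[𝓝 x] _ :=
      hX.eventuallyEq.mlieBracket_vectorField hY.eventuallyEq
    have hXc := (chart_tendsto x).eventually hX.1
    have hYc := (chart_tendsto x).eventually hY.1
    filter_upwards [hb, hXc, hYc, chart_source_mem x] with q hb h1 h2 hq
    have : IsManifold (𝓡 n).tangent (minSmoothness ℝ 2) (TM n M) := by
      rw [minSmoothness_of_isRCLikeNormedField]; infer_instance
    have key := mpullback_mlieBracket (I := (𝓡 n).tangent) (I' := 𝓘(ℝ, E n × E n))
      (f := chart x) (V := Xc) (W := Yc) (x₀ := q) (n := ∞)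
      ((contMDiffAt_vectorSpace_iff_contDiffAt.2 h1).mdifferentiableAt (by simp))
      ((contMDiffAt_vectorSpace_iff_contDiffAt.2 h2).mdifferentiableAt (by simp))
      (chart_contMDiffAt hq) (by
        rw [minSmoothness_of_isRCLikeNormedField]
        exact WithTop.coe_le_coe.2 le_top)
    rw [hb, ← key, mlieBracket_modelSpace Xc Yc]
    exact chartD_mpullback hq _

lemma Rep.add (hX : Rep x X Xc) (hY : Rep x Y Yc) : Rep x (X + Y) (Xc + Yc) := by
  constructor
  · filter_upwards [hX.1, hY.1] with z h1 h2 using h1.add h2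
  · filter_upwards [hX.2, hY.2] with z h1 h2
    simp [h1, h2]

lemma Rep.sub (hX : Rep x X Xc) (hY : Rep x Y Yc) : Rep x (X - Y) (Xc - Yc) := by
  constructor
  · filter_upwards [hX.1, hY.1] with z h1 h2 using h1.sub h2
  · filter_upwards [hX.2, hY.2] with z h1 h2
    simp [h1, h2]

lemma Rep.smul (c : ℝ) (hX : Rep x X Xc) : Rep x (c • X) (c • Xc) := by
  constructor
  · filter_upwards [hX.1] with z h1 using h1.const_smul c
  · filter_upwards [hX.2] with z h1
    simp [h1]

lemma Rep.congr {Xc' : E n × E n → E n × E n} (hX : Rep x X Xc)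
    (h : Xc =ᶠ[𝓝 (chart x x)] Xc') : Rep x X Xc' := by
  constructor
  · filter_upwards [hX.1, h.eventually_nhds] with z h1 h2
    exact h1.congr_of_eventuallyEq (Filter.EventuallyEq.symm h2)
  · filter_upwards [hX.2, (chart_tendsto x).eventually h] with z h1 h2
    rw [h1, h2]

lemma RepFn.congr (hF : RepFn x F Fc) (h : Fc =ᶠ[𝓝 (chart x x)] Fc') : RepFn x F Fc' := by
  constructor
  · filter_upwards [hF.1, h.eventually_nhds] with z h1 h2
    exact h1.congr_of_eventuallyEq (Filter.EventuallyEq.symm h2)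
  · filter_upwards [hF.2, (chart_tendsto x).eventually h] with z h1 h2
    rw [h1, h2]

lemma RepFn.add (hF : RepFn x F Fc) (hF' : RepFn x F' Fc') : RepFn x (F + F') (Fc + Fc') := by
  constructor
  · filter_upwards [hF.1, hF'.1] with z h1 h2 using h1.add h2
  · filter_upwards [hF.2, hF'.2] with z h1 h2
    simp [h1, h2]

lemma RepFn.sub (hF : RepFn x F Fc) (hF' : RepFn x F' Fc') : RepFn x (F - F') (Fc - Fc') := by
  constructor
  · filter_upwards [hF.1, hF'.1] with z h1 h2 using h1.sub h2
  · filter_upwards [hF.2, hF'.2] with z h1 h2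
    simp [h1, h2]

lemma exists_repFn (h : SmoothFnNear F x) : ∃ Fc, RepFn x F Fc := by
  refine ⟨F ∘ (chart x).symm, ?_, ?_⟩
  · filter_upwards [(chart_symm_tendsto x).eventually h, chart_target_mem x] with z h1 hz
    exact (h1.comp z (chart_symm_contMDiffAt hz)).contDiffAt
  · filter_upwards [chart_source_mem x] with q hq
    rw [Function.comp_apply, (chart x).left_inv hq]

lemma smoothFnNear_of_repFn (h : RepFn x F Fc) : SmoothFnNear F x := by
  filter_upwards [(chart_tendsto x).eventually h.1, h.2.eventually_nhds, chart_source_mem x]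
    with q h1 h2 hq
  exact (h1.contMDiffAt.comp q (chart_contMDiffAt hq)).congr_of_eventuallyEq h2

lemma exists_repFn_of_coord (x : TM n M) (h : SmoothNear Fc (chart x x)) :
    ∃ F : TM n M → ℝ, RepFn x F Fc :=
  ⟨Fc ∘ chart x, h, Filter.Eventually.of_forall fun _ => rfl⟩

lemma RepFn.lieD (hX : Rep x X Xc) (hF : RepFn x F Fc) :
    RepFn x (lieD X F) (fun z => fderiv ℝ Fc z (Xc z)) := by
  constructor
  · filter_upwards [hX.1, hF.1] with z h1 h2
    exact (h2.fderiv_right (m := ∞) le_rfl).clm_apply h1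
  · filter_upwards [hX.2, hF.2.eventually_nhds, (chart_tendsto x).eventually hF.1,
      chart_source_mem x] with q h1 h2 h3 hq
    have h4 : F =ᶠ[𝓝 q] Fc ∘ chart x := h2
    rw [← h1, Rapcsak.lieD, h4.mfderiv_eq,
      mfderiv_comp q (h3.differentiableAt (by simp)).mdifferentiableAt
        ((chart_contMDiffAt hq).mdifferentiableAt (by simp)), mfderiv_eq_fderiv]
    rfl

lemma RepFn.jet_eq (hF : RepFn x F Fc) (k : ℕ) :
    jet k F x = fun i : Fin (k + 1) => iteratedFDeriv ℝ i Fc (chart x x) := by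
  funext i
  have : F ∘ (chart x).symm =ᶠ[𝓝 (chart x x)] Fc := by
    filter_upwards [(chart_symm_tendsto x).eventually hF.2, chart_target_mem x] with z h1 hz
    rw [Function.comp_apply, h1, (chart x).right_inv hz]
  exact this.iteratedFDeriv ℝ i |>.eq_of_nhds

lemma RepFn.eq_apply (hF : RepFn x F Fc) : F x = Fc (chart x x) := hF.2.self_of_nhds

end Charts


/-! ### Vertical lift, `J`, `C` and sprays in coordinates -/

section Vertical

variable {n : ℕ} {M : Type*} [TopologicalSpace M] [ChartedSpace (E n) M]
  [IsManifold (𝓡 n) ∞ M]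

variable {x : TM n M} {X S : VField n M} {Xc : E n × E n → E n × E n}

/-- The fibre coordinate is linear in the tangent vector; every computation with vertical lifts
rests on this. -/
lemma chart_apply (x q : TM n M) :
    chart x q = (extChartAt (𝓡 n) x.1 q.1, tangentCoordChange (𝓡 n) q.1 x.1 q.1 q.2) := rfl

lemma mem_chart_source {x q : TM n M} :
    q ∈ (chart x).source ↔ q.1 ∈ (chartAt (E n) x.1).source := by
  rw [extChartAt_source, TangentBundle.mem_chart_source_iff]

/-- Read in the chart, the inclusion of a fibre is the affine map `κ`, whose derivative is visible.
-/
lemma chartD_verticalLift {x q : TM n M} (hq : q ∈ (chart x).source) (w : E n) :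
    chartD x q (verticalLift q w) = (0, tangentCoordChange (𝓡 n) q.1 x.1 q.1 w) := by
  let A := tangentCoordChange (𝓡 n) q.1 x.1 q.1
  let ι : E n → TM n M := fun u => ⟨q.1, u⟩
  let κ : E n → E n × E n := fun u => (extChartAt (𝓡 n) x.1 q.1, A u)
  have hκ (u : E n) : chart x (ι u) = κ u := rfl
  have hmem (u : E n) : ι u ∈ (chart x).source := mem_chart_source.2 (mem_chart_source.1 hq)
  have hκd (u : E n) : HasFDerivAt κ ((0 : E n →L[ℝ] E n).prod A) u :=
    (hasFDerivAt_const _ _).prodMk A.hasFDerivAt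
  -- Differentiability of the fibre inclusion is inherited from this factorization.
  have hι : ι = (chart x).symm ∘ κ := by
    funext u
    rw [Function.comp_apply, ← hκ, (chart x).left_inv (hmem u)]
  let e : E n := q.2
  have hιd : MDifferentiableAt 𝓘(ℝ, E n) (𝓡 n).tangent ι e := by
    rw [hι]
    refine MDifferentiableAt.comp _ ((chart_symm_contMDiffAt ?_).mdifferentiableAt (by simp))
      (hκd e).differentiableAt.mdifferentiableAt
    rw [← hκ]
    exact (chart x).map_source (hmem _)
  have hcomp := mfderiv_comp (I'' := 𝓘(ℝ, E n × E n)) e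
    ((chart_contMDiffAt (hmem e)).mdifferentiableAt (by simp)) hιd
  have hfun : chart x ∘ ι = κ := rfl
  rw [hfun, mfderiv_eq_fderiv, (hκd e).fderiv] at hcomp
  exact (DFunLike.congr_fun hcomp w).symm

lemma mfderiv_extChartAt_self {a b : M} (hb : b ∈ (chartAt (E n) a).source) :
    mfderiv (𝓡 n) 𝓘(ℝ, E n) (extChartAt (𝓡 n) a) b = tangentCoordChange (𝓡 n) b a b := by
  rw [(contMDiffAt_extChartAt' (n := ∞) hb).mdifferentiableAt (by simp) |>.mfderiv]
  rfl

/-- Both sides are derivatives of one map, factored either through the projection to `M` or through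
the chart of `TM`. -/
lemma tangentCoordChange_mfderiv_proj {x q : TM n M} (hq : q ∈ (chart x).source)
    (v : TangentSpace (𝓡 n).tangent q) :
    tangentCoordChange (𝓡 n) q.1 x.1 q.1
      (mfderiv (𝓡 n).tangent (𝓡 n) (fun q : TM n M => q.1) q v) = (chartD x q v).1 := by
  have hb := mem_chart_source.1 hq
  have hproj : MDifferentiableAt (𝓡 n).tangent (𝓡 n) (fun q : TM n M => q.1) q :=
    Bundle.mdifferentiableAt_proj _
  have h1 := mfderiv_comp (I'' := 𝓘(ℝ, E n)) q
    ((contMDiffAt_extChartAt' (I := 𝓡 n) (n := ∞) hb).mdifferentiableAt (by simp)) hproj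
  have h2 := mfderiv_comp (I'' := 𝓘(ℝ, E n)) q (g := (Prod.fst : E n × E n → E n))
    differentiableAt_fst.mdifferentiableAt
    ((chart_contMDiffAt hq).mdifferentiableAt (by simp))
  have h3 : Prod.fst ∘ chart x = extChartAt (𝓡 n) x.1 ∘ fun q : TM n M => q.1 := rfl
  rw [h3, h1, mfderiv_extChartAt_self hb, mfderiv_eq_fderiv, fderiv_fst] at h2
  exact DFunLike.congr_fun h2 v

lemma Rep.J (hX : Rep x X Xc) : Rep x (J X) (fun z => (0, (Xc z).1)) := by
  constructor
  · filter_upwards [hX.1] with z h1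
    exact contDiffAt_const.prodMk h1.fst
  · filter_upwards [hX.2, chart_source_mem x] with q h1 hq
    refine (chartD_verticalLift hq _).trans (Prod.ext rfl ?_)
    rw [← h1]
    exact tangentCoordChange_mfderiv_proj hq _

lemma rep_C (x : TM n M) : Rep x C (fun z => (0, z.2)) := by
  constructor
  · exact Filter.Eventually.of_forall fun z => contDiffAt_const.prodMk contDiffAt_snd
  · filter_upwards [chart_source_mem x] with q hq
    exact chartD_verticalLift hq _

lemma chart_snd_ne_zero_iff {x q : TM n M} (hq : q ∈ (chart x).source) :
    (chart x q).2 ≠ 0 ↔ q ∈ slit n M := by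
  have hb := mem_chart_source.1 hq
  have hinj : Function.Injective (tangentCoordChange (𝓡 n) q.1 x.1 q.1) := by
    rw [← mfderiv_extChartAt_self hb]
    exact (isInvertible_mfderiv_extChartAt (by rwa [extChartAt_source])).injective
  rw [chart_apply]
  exact (map_ne_zero_iff _ hinj)

lemma slit_mem_nhds (hx : x ∈ slit n M) : slit n M ∈ 𝓝 x := by
  have h1 : ∀ᶠ q in 𝓝 x, (chart x q).2 ≠ 0 :=
    (continuous_snd.continuousAt.tendsto.comp (chart_tendsto x)).eventually_ne
      ((chart_snd_ne_zero_iff (mem_extChartAt_source x)).2 hx)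
  filter_upwards [h1, chart_source_mem x] with q h1 hq
  exact (chart_snd_ne_zero_iff hq).1 h1

/-- A spray is `(y, s)` in a chart of `TM`, with `s` positively homogeneous of degree two. -/
lemma IsSpray.exists_rep (hS : IsSpray S) (hx : x ∈ slit n M) :
    ∃ s : E n × E n → E n, SmoothNear s (chart x x) ∧ Rep x S (fun z => (z.2, s z)) ∧
      ∀ᶠ z in 𝓝 (chart x x), fderiv ℝ s z (0, z.2) = (2 : ℝ) • s z := by
  have hsm : SmoothVFNear S x := by
    filter_upwards [eventually_eventually_nhds.2 (slit_mem_nhds hx)] with q hq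
    exact hS.smooth.contMDiffAt hq
  obtain ⟨Sc, hSc⟩ := Rapcsak.exists_rep hsm
  -- The spray identities hold only on the slit bundle, which is a neighbourhood of x, so they pass
  -- to germs of coordinate expressions.
  have hpull {A B : VField n M} {Ac Bc : E n × E n → E n × E n} (hA : Rep x A Ac)
      (hB : Rep x B Bc) (h : ∀ p ∈ slit n M, A p = B p) : Ac =ᶠ[𝓝 (chart x x)] Bc := by
    filter_upwards [(chart_symm_tendsto x).eventually hA.2,
      (chart_symm_tendsto x).eventually hB.2, chart_target_mem x,
      (chart_symm_tendsto x).eventually (slit_mem_nhds hx)] with z h1 h2 hz hs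
    rw [(chart x).right_inv hz] at h1 h2
    rw [← h1, ← h2, h _ hs]
  have hJ := hpull hSc.J (rep_C x) hS.J_eq
  have hSc' : Sc =ᶠ[𝓝 (chart x x)] fun z => (z.2, (Sc z).2) := by
    filter_upwards [hJ] with z h
    exact Prod.ext (congrArg Prod.snd h) rfl
  have hrep := hSc.congr hSc'
  have hs : SmoothNear (fun z => (Sc z).2) (chart x x) := by
    filter_upwards [hSc.1] with z h using h.snd
  refine ⟨fun z => (Sc z).2, hs, hrep, ?_⟩
  filter_upwards [hpull ((rep_C x).bracket hrep) hrep hS.bracket_eq, hs] with z h h2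
  have hd := (h2.differentiableAt (by simp)).hasFDerivAt
  have e1 : HasFDerivAt (fun z : E n × E n => (z.2, (Sc z).2)) ((ContinuousLinearMap.snd ℝ (E n) (E n)).prod _) z :=
    hasFDerivAt_snd.prodMk hd
  have e2 : HasFDerivAt (fun z : E n × E n => ((0 : E n), z.2)) 
      ((0 : E n × E n →L[ℝ] E n).prod (ContinuousLinearMap.snd ℝ (E n) (E n))) z :=
    (hasFDerivAt_const _ _).prodMk hasFDerivAt_snd
  -- The second component of [C, S] = S reads ds(0, y) − s = s.
  rw [VectorField.lieBracket_eq] at h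
  simp only [e1.fderiv, e2.fderiv] at h
  have := congrArg Prod.snd h
  simp at this
  rw [sub_eq_iff_eq_add] at this
  rw [this, two_smul]

end Vertical

/-! ### Coefficients of the connection, the curvature and the operators -/

section Coordinates

variable {n : ℕ}

/-- The horizontal lift at `z` of `u`, for the connection of the spray `(y, s)`. -/
def hlift (s : E n × E n → E n) (z : E n × E n) (u : E n) : E n × E n :=
  (u, (1 / 2 : ℝ) • fderiv ℝ s z (0, u))

/-- The second derivative of `F`. -/
abbrev D2 {G : Type*} [NormedAddCommGroup G] [NormedSpace ℝ G] (F : E n × E n → G)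
    (z : E n × E n) : E n × E n →L[ℝ] E n × E n →L[ℝ] G :=
  fderiv ℝ (fderiv ℝ F) z

/-- The coefficients of the curvature of the connection of the spray `(y, s)`. -/
def curvCoeff (s : E n × E n → E n) (z : E n × E n) (u v : E n) : E n :=
  (1 / 2 : ℝ) • (D2 s z (hlift s z u) (0, v) - D2 s z (hlift s z v) (0, u))

/-- The coefficients of `P_Γ F / 2`. -/
def gammaCoeff (s : E n × E n → E n) (F : E n × E n → ℝ) (u v : E n) (z : E n × E n) : ℝ :=
  D2 F z (hlift s z u) (0, v) - D2 F z (hlift s z v) (0, u)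

/-- The coefficients of `i_R dd_J F`. -/
def obstruction (s : E n × E n → E n) (F : E n × E n → ℝ) (z : E n × E n) (u v w : E n) : ℝ :=
  D2 F z (0, curvCoeff s z u v) (0, w) + D2 F z (0, curvCoeff s z v w) (0, u)
    + D2 F z (0, curvCoeff s z w u) (0, v)

variable {G : Type*} [NormedAddCommGroup G] [NormedSpace ℝ G]

lemma SmoothNear.fderiv {f : E n × E n → G} {z₀ : E n × E n} (hf : SmoothNear f z₀) :
    SmoothNear (fderiv ℝ f) z₀ := by
  filter_upwards [hf] with z h using h.fderiv_right (m := ∞) le_rfl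

lemma SmoothNear.hasFDerivAt {f : E n × E n → G} {z₀ : E n × E n} (hf : SmoothNear f z₀) :
    ∀ᶠ z in 𝓝 z₀, HasFDerivAt f (_root_.fderiv ℝ f z) z := by
  filter_upwards [hf] with z h using (h.differentiableAt (by simp)).hasFDerivAt

lemma hasFDerivAt_vertical {a : E n × E n → E n × E n} {a' : E n × E n →L[ℝ] E n × E n}
    {z : E n × E n} (ha : HasFDerivAt a a' z) :
    HasFDerivAt (fun z => ((0 : E n), (a z).1))
      ((0 : E n × E n →L[ℝ] E n).prod ((ContinuousLinearMap.fst ℝ (E n) (E n)).comp a')) z :=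
  (hasFDerivAt_const _ _).prodMk ha.fst

lemma hasFDerivAt_fderiv_apply {f : E n × E n → G} {a : E n × E n → E n × E n}
    {a' : E n × E n →L[ℝ] E n × E n} {z : E n × E n}
    (hf : HasFDerivAt (fderiv ℝ f) (D2 f z) z) (ha : HasFDerivAt a a' z) (w : E n × E n) :
    fderiv ℝ (fun z => fderiv ℝ f z (a z)) z w = D2 f z w (a z) + fderiv ℝ f z (a' w) := by
  rw [(hf.clm_apply ha).fderiv]
  simp [add_comm]

lemma hasFDerivAt_hlift {s : E n × E n → E n} {a : E n × E n → E n × E n}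
    {a' : E n × E n →L[ℝ] E n × E n} {z : E n × E n}
    (hs : HasFDerivAt (fderiv ℝ s) (D2 s z) z) (ha : HasFDerivAt a a' z) (w : E n × E n) :
    fderiv ℝ (fun z => hlift s z (a z).1) z w =
      ((a' w).1, (1 / 2 : ℝ) • (D2 s z w (0, (a z).1) + fderiv ℝ s z (0, (a' w).1))) := by
  have h := ha.fst.prodMk ((hs.clm_apply (hasFDerivAt_vertical ha)).const_smul (1 / 2 : ℝ))
  have h' : HasFDerivAt (fun z => hlift s z (a z).1) _ z := h
  rw [h'.fderiv]
  simp [add_comm]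

end Coordinates

/-! ### The forms of the system in coordinates -/

section Forms

variable {n : ℕ} {M : Type*} [TopologicalSpace M] [ChartedSpace (E n) M]
  [IsManifold (𝓡 n) ∞ M]

variable {x : TM n M} {X Y Z S : VField n M} {Xc Yc Zc : E n × E n → E n × E n}
  {F : TM n M → ℝ} {Fc : E n × E n → ℝ} {s : E n × E n → E n}

lemma RepFn.PC (hF : RepFn x F Fc) :
    RepFn x (PC F) (fun z => fderiv ℝ Fc z (0, z.2) - Fc z) :=
  (hF.lieD (rep_C x)).sub hF

/-- The terms with derivatives of X and Y cancel against J[X, Y]F, leaving only Hessian terms. -/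
lemma RepFn.ddJ (hF : RepFn x F Fc) (hX : Rep x X Xc) (hY : Rep x Y Yc) :
    RepFn x (ddJ F X Y)
      (fun z => D2 Fc z (Xc z) (0, (Yc z).1) - D2 Fc z (Yc z) (0, (Xc z).1)) := by
  refine ((((hF.lieD hY.J).lieD hX).sub ((hF.lieD hX.J).lieD hY)).sub
    (hF.lieD (hX.bracket hY).J)).congr ?_
  filter_upwards [hF.1.fderiv.hasFDerivAt, hX.1.hasFDerivAt, hY.1.hasFDerivAt] with z hF hX hY
  simp only [Pi.sub_apply, lieBracket_eq]
  rw [hasFDerivAt_fderiv_apply hF (hasFDerivAt_vertical hY),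
    hasFDerivAt_fderiv_apply hF (hasFDerivAt_vertical hX)]
  have : ((0 : E n), (fderiv ℝ Yc z (Xc z) - fderiv ℝ Xc z (Yc z)).1) =
      (0, (fderiv ℝ Yc z (Xc z)).1) - (0, (fderiv ℝ Xc z (Yc z)).1) := by simp
  rw [this, map_sub]
  simp
  ring

lemma Rep.connection (hS : Rep x S (fun z => (z.2, s z))) (hs : SmoothNear s (chart x x))
    (hX : Rep x X Xc) : Rep x (connection S X)
      (fun z => ((Xc z).1, fderiv ℝ s z (0, (Xc z).1) - (Xc z).2)) := by
  refine ((hX.J.bracket hS).sub (hX.bracket hS).J).congr ?_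
  filter_upwards [hs.hasFDerivAt, hX.1.hasFDerivAt] with z hs hX
  have hSd : HasFDerivAt (fun z : E n × E n => (z.2, s z))
      ((ContinuousLinearMap.snd ℝ (E n) (E n)).prod (fderiv ℝ s z)) z :=
    hasFDerivAt_snd.prodMk hs
  simp only [Pi.sub_apply, lieBracket_eq, hSd.fderiv, (hasFDerivAt_vertical hX).fderiv]
  ext <;> simp

lemma Rep.horizontal (hS : Rep x S (fun z => (z.2, s z))) (hs : SmoothNear s (chart x x))
    (hX : Rep x X Xc) : Rep x (horizontal S X) (fun z => hlift s z (Xc z).1) := by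
  refine ((hX.add (hS.connection hs hX)).smul (1 / 2 : ℝ)).congr
    (Filter.Eventually.of_forall fun z => ?_)
  refine Prod.ext ?_ ?_
  · simp only [Pi.smul_apply, Pi.add_apply, Prod.smul_fst, Prod.fst_add, hlift]
    module
  · simp only [Pi.smul_apply, Pi.add_apply, Prod.smul_snd, Prod.snd_add, hlift]
    module

lemma RepFn.PGamma (hS : Rep x S (fun z => (z.2, s z))) (hs : SmoothNear s (chart x x))
    (hF : RepFn x F Fc) (hX : Rep x X Xc) (hY : Rep x Y Yc) :
    RepFn x (PGamma S F X Y) (fun z => 2 * gammaCoeff s Fc (Xc z).1 (Yc z).1 z) := by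
  refine ((hF.ddJ (hS.connection hs hX) hY).add (hF.ddJ hX (hS.connection hs hY))).congr
    (Filter.Eventually.of_forall fun z => ?_)
  -- This is Γ = 2h − Id. It cancels the terms in the full vectors, so only the horizontal
  -- components of X and Y survive.
  have key (a : E n × E n) : (a.1, fderiv ℝ s z (0, a.1) - a.2) =
      (2 : ℝ) • hlift s z a.1 - a := by
    refine Prod.ext ?_ ?_
    · simp only [Prod.fst_sub, Prod.smul_fst, hlift]
      module
    · simp only [Prod.snd_sub, Prod.smul_snd, hlift]
      module
  simp only [Pi.add_apply, key, map_sub, map_smul, sub_apply,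
    smul_apply, smul_eq_mul, gammaCoeff]
  ring

/-- All derivatives of X and Y drop out of ½[h, h], and so do the horizontal components: R is
tensorial and vertical valued. -/
lemma Rep.curvature (hS : Rep x S (fun z => (z.2, s z))) (hs : SmoothNear s (chart x x))
    (hX : Rep x X Xc) (hY : Rep x Y Yc) :
    Rep x (curvature S X Y) (fun z => (0, curvCoeff s z (Xc z).1 (Yc z).1)) := by
  have hh {V : VField n M} {Vc} (hV : Rep x V Vc) := hS.horizontal hs hV
  have hXY := hX.bracket hY
  have hhh := (hh hX).bracket (hh hY)
  refine ((((((((hhh.add hhh).add (hh (hh hXY))).add (hh (hh hXY))).sub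
    (hh ((hh hX).bracket hY))).sub (hh (hX.bracket (hh hY)))).sub
    (hh ((hh hX).bracket hY))).sub (hh (hX.bracket (hh hY)))).smul (1 / 2 : ℝ)).congr ?_
  filter_upwards [hs.fderiv.hasFDerivAt, hX.1.hasFDerivAt, hY.1.hasFDerivAt] with z hs hX hY
  simp only [Pi.smul_apply, Pi.add_apply, Pi.sub_apply, lieBracket_eq, hasFDerivAt_hlift hs hX,
    hasFDerivAt_hlift hs hY]
  have hv (a b : E n) : ((0 : E n), a - b) = (0, a) - (0, b) := by simp
  refine Prod.ext ?_ ?_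
  · simp only [hlift, Prod.smul_fst, Prod.fst_add, Prod.fst_sub]
    module
  · simp only [hlift, Prod.smul_snd, Prod.snd_add, Prod.snd_sub, Prod.fst_sub, curvCoeff, hv,
      map_sub]
    module

/-- As R is vertical valued, JR = 0, and one of the two Hessian terms of dd_J F disappears in each
summand. -/
lemma RepFn.ins2_curvature (hS : Rep x S (fun z => (z.2, s z)))
    (hs : SmoothNear s (chart x x)) (hF : RepFn x F Fc) (hX : Rep x X Xc) (hY : Rep x Y Yc)
    (hZ : Rep x Z Zc) : RepFn x (ins2 (curvature S) (Rapcsak.ddJ F) X Y Z)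
      (fun z => obstruction s Fc z (Xc z).1 (Yc z).1 (Zc z).1) := by
  refine (((hF.ddJ (hS.curvature hs hX hY) hZ).add (hF.ddJ (hS.curvature hs hY hZ) hX)).add
    (hF.ddJ (hS.curvature hs hZ hX) hY)).congr (Filter.Eventually.of_forall fun z => ?_)
  have h0 : ((0 : E n), (0 : E n)) = 0 := rfl
  simp only [Pi.add_apply, h0, map_zero, obstruction, sub_zero]

end Forms


/-! ### Linear algebra of the prolonged symbol -/

section Trilinear

lemma exists_trilinear_eq {U V W : Type*} [AddCommGroup U] [Module ℝ U] [AddCommGroup V]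
    [Module ℝ V] [AddCommGroup W] [Module ℝ W] (f : U → V → W → ℝ)
    (h₁ : ∀ v w, IsLinearMap ℝ fun u => f u v w) (h₂ : ∀ u w, IsLinearMap ℝ fun v => f u v w)
    (h₃ : ∀ u v, IsLinearMap ℝ fun w => f u v w) :
    ∃ T : U →ₗ[ℝ] V →ₗ[ℝ] W →ₗ[ℝ] ℝ, ∀ u v w, T u v w = f u v w := by
  refine ⟨{
    toFun := fun u => LinearMap.mk₂ ℝ (f u) (fun v v' w => (h₂ u w).map_add v v')
      (fun c v w => (h₂ u w).map_smul c v) (fun v w w' => (h₃ u v).map_add w w')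
      (fun c v w => (h₃ u v).map_smul c w)
    map_add' := fun u u' => ?_
    map_smul' := fun c u => ?_ }, fun u v w => rfl⟩
  · ext v w
    exact (h₁ v w).map_add u u'
  · ext v w
    exact (h₁ v w).map_smul c u

variable {G : Type*} [NormedAddCommGroup G] [NormedSpace ℝ G] {y : G}

/-- A symmetric bilinear form is the contraction with `y ≠ 0` of a symmetric trilinear form. -/
lemma exists_symm_contraction (hy : y ≠ 0) (g : G →ₗ[ℝ] G →ₗ[ℝ] ℝ) (hg : ∀ u v, g u v = g v u) :
    ∃ T : G →ₗ[ℝ] G →ₗ[ℝ] G →ₗ[ℝ] ℝ, (∀ u v w, T u v w = T v u w) ∧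
      (∀ u v w, T u v w = T u w v) ∧ ∀ u v, T y u v = g u v := by
  obtain ⟨l, hl⟩ := SeparatingDual.exists_eq_one (R := ℝ) hy
  -- With l(y) = 1, an inclusion–exclusion: the symmetrized l ⊗ g contracts with y to g plus terms
  -- containing l, which the later terms remove.
  obtain ⟨T, hT⟩ := exists_trilinear_eq (fun u v w : G =>
    l u * g v w + l v * g u w + l w * g u v
      - (l u * l v * g y w + l v * l w * g y u + l w * l u * g y v) + l u * l v * l w * g y y)
    (fun v w => ⟨fun _ _ => by simp; ring, fun _ _ => by simp; ring⟩)
    (fun u w => ⟨fun _ _ => by simp; ring, fun _ _ => by simp; ring⟩)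
    (fun u v => ⟨fun _ _ => by simp; ring, fun _ _ => by simp; ring⟩)
  refine ⟨T, fun u v w => ?_, fun u v w => ?_, fun u v => ?_⟩
  · rw [hT, hT, hg u v]; ring
  · rw [hT, hT, hg v w]; ring
  · rw [hT, hl]; ring

/-- The kernel of the cyclic sum is the image of `U ↦ U u v w - U v u w`. -/
lemma exists_antisymm_potential (B : G →ₗ[ℝ] G →ₗ[ℝ] G →ₗ[ℝ] ℝ)
    (hB : ∀ w u v, B w u v = -B w v u) (hc : ∀ u v w, B w u v + B u v w + B v w u = 0) :
    ∃ U : G →ₗ[ℝ] G →ₗ[ℝ] G →ₗ[ℝ] ℝ, (∀ u v w, U u v w = U u w v) ∧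
      ∀ u v w, U u v w - U v u w = B w u v := by
  -- Antisymmetrizing B w u v + B v u w in u and v gives 2 B w u v − B v w u − B u v w, which the
  -- cyclic identity turns into 3 B w u v.
  obtain ⟨U, hU⟩ := exists_trilinear_eq (fun u v w : G => (1 / 3 : ℝ) * (B w u v + B v u w))
    (fun v w => ⟨fun _ _ => by simp; ring, fun _ _ => by simp; ring⟩)
    (fun u w => ⟨fun _ _ => by simp; ring, fun _ _ => by simp; ring⟩)
    (fun u v => ⟨fun _ _ => by simp; ring, fun _ _ => by simp; ring⟩)
  refine ⟨U, fun u v w => ?_, fun u v w => ?_⟩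
  · rw [hU, hU]; ring
  · rw [hU, hU]
    linarith [hB w u v, hB v u w, hB u v w, hc u v w]

/-- Adding a totally symmetric form to a potential of B disturbs neither its symmetry nor its
antisymmetrization. By `hg` the error in the contraction with y is symmetric, so such a form can
correct it. -/
lemma exists_potential_contraction_right (hy : y ≠ 0) (B : G →ₗ[ℝ] G →ₗ[ℝ] G →ₗ[ℝ] ℝ)
    (hB : ∀ w u v, B w u v = -B w v u) (hc : ∀ u v w, B w u v + B u v w + B v w u = 0)
    (g : G →ₗ[ℝ] G →ₗ[ℝ] ℝ) (hg : ∀ u v, g u v - g v u = B y u v) :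
    ∃ U : G →ₗ[ℝ] G →ₗ[ℝ] G →ₗ[ℝ] ℝ, (∀ u v w, U u v w = U u w v) ∧
      (∀ u v w, U u v w - U v u w = B w u v) ∧ ∀ u v, U u v y = g u v := by
  obtain ⟨U, hU, hUB⟩ := exists_antisymm_potential B hB hc
  have hU' (u v : G) : U u v y = (U.compr₂ (LinearMap.applyₗ y)) u v := rfl
  obtain ⟨T, hT₁, hT₂, hTy⟩ := exists_symm_contraction hy (g - U.compr₂ (LinearMap.applyₗ y))
    fun u v => by
      simp only [LinearMap.sub_apply, ← hU']
      linarith [hg u v, hUB u v y]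
  refine ⟨U + T, fun u v w => ?_, fun u v w => ?_, fun u v => ?_⟩
  · simp [hU u v w, hT₂ u v w]
  · simp only [LinearMap.add_apply]
    linarith [hUB u v w, hT₁ u v w]
  · simp only [LinearMap.add_apply]
    rw [hT₂, hT₁, hTy, LinearMap.sub_apply, LinearMap.sub_apply, ← hU']
    ring

/-- Here the contraction is in the first slot, so it is symmetric already because the other two
slots are; no condition links g to B. -/
lemma exists_potential_contraction_left (hy : y ≠ 0) (B : G →ₗ[ℝ] G →ₗ[ℝ] G →ₗ[ℝ] ℝ)
    (hB : ∀ w u v, B w u v = -B w v u) (hc : ∀ u v w, B w u v + B u v w + B v w u = 0)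
    (g : G →ₗ[ℝ] G →ₗ[ℝ] ℝ) (hg : ∀ u v, g u v = g v u) :
    ∃ U : G →ₗ[ℝ] G →ₗ[ℝ] G →ₗ[ℝ] ℝ, (∀ u v w, U u v w = U u w v) ∧
      (∀ u v w, U u v w - U v u w = B w u v) ∧ ∀ u v, U y u v = g u v := by
  obtain ⟨U, hU, hUB⟩ := exists_antisymm_potential B hB hc
  obtain ⟨T, hT₁, hT₂, hTy⟩ := exists_symm_contraction hy (g - U y)
    fun u v => by simp [hg u v, hU y u v]
  refine ⟨U + T, fun u v w => ?_, fun u v w => ?_, fun u v => ?_⟩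
  · simp [hU u v w, hT₂ u v w]
  · simp only [LinearMap.add_apply]
    linarith [hUB u v w, hT₁ u v w]
  · simp [hTy]

/-- Solvability of the prolonged symbol equations: a symmetric trilinear form on `G × G` with
prescribed antisymmetrization along the horizontal lift `u ↦ (u, σ u)` and prescribed contraction
with `(0, y)`. -/
lemma exists_symm_trilinear (hy : y ≠ 0) (σ : G →ₗ[ℝ] G)
    (B : G × G →ₗ[ℝ] G →ₗ[ℝ] G →ₗ[ℝ] ℝ) (hB : ∀ w u v, B w u v = -B w v u)
    (hv : ∀ u v w, B (0, w) u v + B (0, u) v w + B (0, v) w u = 0)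
    (hh : ∀ u v w, B (w, σ w) u v + B (u, σ u) v w + B (v, σ v) w u = 0)
    (Q : G × G →ₗ[ℝ] G × G →ₗ[ℝ] ℝ) (hQ : ∀ a b, Q a b = Q b a)
    (hBQ : ∀ u v, B (0, y) u v = Q (u, σ u) (0, v) - Q (v, σ v) (0, u)) :
    ∃ T : G × G →ₗ[ℝ] G × G →ₗ[ℝ] G × G →ₗ[ℝ] ℝ, (∀ a b c, T a b c = T b a c) ∧
      (∀ a b c, T a b c = T a c b) ∧
      (∀ w u v, T w (u, σ u) (0, v) - T w (v, σ v) (0, u) = B w u v) ∧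
      ∀ a b, T a b (0, y) = Q a b := by
  let ver : G →ₗ[ℝ] G × G := LinearMap.inr ℝ G G
  let hor : G →ₗ[ℝ] G × G := LinearMap.id.prod σ
  have hver (u : G) : ver u = (0, u) := rfl
  have hhor (u : G) : hor u = (u, σ u) := rfl
  simp only [← hver, ← hhor] at *
  -- In the splitting into horizontal and vertical parts, `R`, `U` and `W` are the components of T
  -- with three, two and one vertical arguments.
  obtain ⟨R, hR₁, hR₂, hRy⟩ := exists_symm_contraction hy (Q.compl₁₂ ver ver)
    fun u v => hQ _ _
  obtain ⟨U, hU, hUB, hUy⟩ := exists_potential_contraction_right hy (B ∘ₗ ver)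
    (fun w u v => hB _ _ _) hv (Q.compl₁₂ hor ver) fun u v => (hBQ u v).symm
  -- The vertical argument is the first slot of `W`, so the equation along hor w reads W v w u − W u
  -- w v = B (hor w) u v; this order of u and v accounts for the minus sign.
  obtain ⟨W, hW, hWB, hWy⟩ := exists_potential_contraction_left hy (B ∘ₗ (-hor))
    (fun w u v => hB _ _ _)
    (fun u v w => by
      simp only [LinearMap.neg_apply, LinearMap.comp_apply, map_neg]
      linarith [hh u v w])
    (Q.compl₁₂ hor hor) fun u v => hQ _ _
  let p : G × G →ₗ[ℝ] G := LinearMap.fst ℝ G G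
  let q : G × G →ₗ[ℝ] G := LinearMap.snd ℝ G G - σ ∘ₗ LinearMap.fst ℝ G G
  have hph (u : G) : p (hor u) = u := rfl
  have hpv (u : G) : p (ver u) = 0 := rfl
  have hqh (u : G) : q (hor u) = 0 := by simp [q, hor]
  have hqv (u : G) : q (ver u) = u := by simp [q, ver]
  have hsplit (a : G × G) : a = hor (p a) + ver (q a) := by
    ext <;> simp [hor, ver, p, q]
  obtain ⟨T, hT⟩ := exists_trilinear_eq (fun a b c : G × G => R (q a) (q b) (q c)
      + (U (p a) (q b) (q c) + U (p b) (q a) (q c) + U (p c) (q a) (q b))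
      + (W (q a) (p b) (p c) + W (q b) (p a) (p c) + W (q c) (p a) (p b)))
    (fun v w => ⟨fun _ _ => by simp only [map_add, LinearMap.add_apply]; ring,
      fun _ _ => by simp only [map_smul, LinearMap.smul_apply, smul_eq_mul]; ring⟩)
    (fun u w => ⟨fun _ _ => by simp only [map_add, LinearMap.add_apply]; ring,
      fun _ _ => by simp only [map_smul, LinearMap.smul_apply, smul_eq_mul]; ring⟩)
    (fun u v => ⟨fun _ _ => by simp only [map_add, LinearMap.add_apply]; ring,
      fun _ _ => by simp only [map_smul, LinearMap.smul_apply, smul_eq_mul]; ring⟩)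
  refine ⟨T, fun a b c => ?_, fun a b c => ?_, fun w u v => ?_, fun a b => ?_⟩
  · rw [hT, hT, hR₁, hU (p c), hW (q c)]
    ring
  · rw [hT, hT, hR₂, hU (p a), hW (q a)]
    ring
  · have e₁ := hUB u v (q w)
    have e₂ := hWB v u (p w)
    rw [LinearMap.comp_apply] at e₁
    rw [LinearMap.comp_apply, LinearMap.neg_apply, map_neg, LinearMap.neg_apply,
      LinearMap.neg_apply, ← hB] at e₂
    conv_rhs => rw [hsplit w]
    rw [hT, hT]
    simp only [hph, hpv, hqh, hqv, map_zero, LinearMap.zero_apply, map_add, LinearMap.add_apply]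
    rw [← e₁, ← e₂, hU u v, hU v u, hW v u, hW u v]
    ring
  · rw [hT]
    simp only [hpv, hqv, map_zero, LinearMap.zero_apply]
    have e₁ : R (q a) (q b) y = Q (ver (q a)) (ver (q b)) := by
      rw [hR₂, hR₁, hRy]; rfl
    have e₂ := hUy (p a) (q b)
    have e₃ := hUy (p b) (q a)
    have e₄ := hWy (p a) (p b)
    simp only [LinearMap.compl₁₂_apply] at e₂ e₃ e₄
    rw [e₁, e₂, e₃, e₄, hQ (hor (p b))]
    conv_rhs => rw [hsplit a, hsplit b]
    simp only [map_add, LinearMap.add_apply]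
    ring

/-- A trilinear form on a finite dimensional space, as a continuous one. -/
lemma exists_continuous_trilinear_eq {V : Type*} [NormedAddCommGroup V] [NormedSpace ℝ V]
    [FiniteDimensional ℝ V] (T : V →ₗ[ℝ] V →ₗ[ℝ] V →ₗ[ℝ] ℝ) :
    ∃ T' : V →L[ℝ] V →L[ℝ] V →L[ℝ] ℝ, ∀ a b c, T' a b c = T a b c := by
  let f : (V →ₗ[ℝ] ℝ) →ₗ[ℝ] V →L[ℝ] ℝ := LinearEquiv.toLinearMap LinearMap.toContinuousLinearMap
  let g : (V →ₗ[ℝ] V →L[ℝ] ℝ) →ₗ[ℝ] V →L[ℝ] V →L[ℝ] ℝ := LinearEquiv.toLinearMap LinearMap.toContinuousLinearMap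
  exact ⟨LinearMap.toContinuousLinearMap
    { toFun := fun a => g (f ∘ₗ T a)
      map_add' := fun a b => by rw [map_add, LinearMap.comp_add, map_add]
      map_smul' := fun c a => by rw [map_smul, LinearMap.comp_smul, map_smul]; rfl },
    fun a b c => rfl⟩

end Trilinear


/-! ### Modifying the third derivative at a point -/

section Cubic

variable {V : Type*} [NormedAddCommGroup V] [NormedSpace ℝ V]

/-- The cubic polynomial with third derivative `T` and vanishing `2`-jet at `z₀`. -/
def cubic (T : V →L[ℝ] V →L[ℝ] V →L[ℝ] ℝ) (z₀ z : V) : ℝ :=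
  (1 / 6 : ℝ) * T (z - z₀) (z - z₀) (z - z₀)

variable {T : V →L[ℝ] V →L[ℝ] V →L[ℝ] ℝ} {z₀ : V}

lemma hasFDerivAt_clm_sub {G : Type*} [NormedAddCommGroup G] [NormedSpace ℝ G] (L : V →L[ℝ] G)
    (z₀ z : V) : HasFDerivAt (fun z => L (z - z₀)) L z :=
  L.hasFDerivAt.comp z ((hasFDerivAt_id z).sub_const z₀)

lemma contDiff_clm_sub {G : Type*} [NormedAddCommGroup G] [NormedSpace ℝ G] (L : V →L[ℝ] G)
    (z₀ : V) : ContDiff ℝ ∞ fun z => L (z - z₀) :=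
  L.contDiff.comp (contDiff_id.sub contDiff_const)

lemma contDiff_cubic : ContDiff ℝ ∞ (cubic T z₀) := by
  have h : ContDiff ℝ ∞ (fun z : V => z - z₀) := contDiff_id.sub contDiff_const
  exact contDiff_const.mul
    (((contDiff_clm_sub (G := V →L[ℝ] V →L[ℝ] ℝ) T z₀).clm_apply h).clm_apply h)

lemma fderiv_cubic (h₁ : ∀ a b c, T a b c = T b a c) (h₂ : ∀ a b c, T a b c = T a c b) :
    fderiv ℝ (cubic T z₀) = fun z => (1 / 2 : ℝ) • T (z - z₀) (z - z₀) := by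
  funext z
  have h : HasFDerivAt (fun z : V => z - z₀) (ContinuousLinearMap.id ℝ V) z :=
    (hasFDerivAt_id z).sub_const z₀
  have key : HasFDerivAt (cubic T z₀) _ z :=
    (((hasFDerivAt_clm_sub (G := V →L[ℝ] V →L[ℝ] ℝ) T z₀ z).clm_apply h).clm_apply h).const_mul (1 / 6 : ℝ)
  rw [key.fderiv]
  refine ContinuousLinearMap.ext fun w => ?_
  simp only [smul_apply, add_apply, ContinuousLinearMap.comp_apply, ContinuousLinearMap.flip_apply,
    ContinuousLinearMap.id_apply, smul_eq_mul]
  rw [h₁ w, h₂ _ w]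
  ring

lemma fderiv_fderiv_cubic (h₁ : ∀ a b c, T a b c = T b a c) (h₂ : ∀ a b c, T a b c = T a c b) :
    fderiv ℝ (fderiv ℝ (cubic T z₀)) = fun z => T (z - z₀) := by
  funext z
  have h : HasFDerivAt (fun z : V => z - z₀) (ContinuousLinearMap.id ℝ V) z :=
    (hasFDerivAt_id z).sub_const z₀
  have key : HasFDerivAt (fun z => (1 / 2 : ℝ) • T (z - z₀) (z - z₀)) _ z :=
    ((hasFDerivAt_clm_sub (G := V →L[ℝ] V →L[ℝ] ℝ) T z₀ z).clm_apply h).const_smul (1 / 2 : ℝ)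
  rw [fderiv_cubic h₁ h₂, key.fderiv]
  refine ContinuousLinearMap.ext fun w => ContinuousLinearMap.ext fun w' => ?_
  simp only [smul_apply, add_apply, ContinuousLinearMap.comp_apply, ContinuousLinearMap.flip_apply,
    ContinuousLinearMap.id_apply, smul_eq_mul]
  rw [h₁ w]
  ring

lemma fderiv_fderiv_fderiv_cubic (h₁ : ∀ a b c, T a b c = T b a c)
    (h₂ : ∀ a b c, T a b c = T a c b) (z : V) :
    fderiv ℝ (fderiv ℝ (fderiv ℝ (cubic T z₀))) z = T := by
  rw [fderiv_fderiv_cubic h₁ h₂]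
  exact (hasFDerivAt_clm_sub (G := V →L[ℝ] V →L[ℝ] ℝ) T z₀ z).fderiv

variable {G : Type*} [NormedAddCommGroup G] [NormedSpace ℝ G] {f g : V → G}

lemma eventually_contDiffAt_fderiv (hf : ∀ᶠ z in 𝓝 z₀, ContDiffAt ℝ ∞ f z) :
    ∀ᶠ z in 𝓝 z₀, ContDiffAt ℝ ∞ (fderiv ℝ f) z := by
  filter_upwards [hf] with z h using h.fderiv_right (m := ∞) le_rfl

lemma fderiv_add_eventuallyEq (hf : ∀ᶠ z in 𝓝 z₀, ContDiffAt ℝ ∞ f z)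
    (hg : ∀ᶠ z in 𝓝 z₀, ContDiffAt ℝ ∞ g z) :
    fderiv ℝ (f + g) =ᶠ[𝓝 z₀] fderiv ℝ f + fderiv ℝ g := by
  filter_upwards [hf, hg] with z h h'
  exact fderiv_add (h.differentiableAt (by simp)) (h'.differentiableAt (by simp))

lemma fderiv_fderiv_add_eventuallyEq (hf : ∀ᶠ z in 𝓝 z₀, ContDiffAt ℝ ∞ f z)
    (hg : ∀ᶠ z in 𝓝 z₀, ContDiffAt ℝ ∞ g z) :
    fderiv ℝ (fderiv ℝ (f + g)) =ᶠ[𝓝 z₀] fderiv ℝ (fderiv ℝ f) + fderiv ℝ (fderiv ℝ g) :=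
  (fderiv_add_eventuallyEq hf hg).fderiv.trans
    (fderiv_add_eventuallyEq (eventually_contDiffAt_fderiv hf) (eventually_contDiffAt_fderiv hg))

/-- Adding `cubic T z₀` to a function does not change its `2`-jet at `z₀`, and adds `T` to its
third derivative. -/
lemma derivatives_add_cubic {f : V → ℝ} (hf : ∀ᶠ z in 𝓝 z₀, ContDiffAt ℝ ∞ f z)
    (h₁ : ∀ a b c, T a b c = T b a c) (h₂ : ∀ a b c, T a b c = T a c b) :
    (f + cubic T z₀) z₀ = f z₀ ∧ fderiv ℝ (f + cubic T z₀) z₀ = fderiv ℝ f z₀ ∧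
      fderiv ℝ (fderiv ℝ (f + cubic T z₀)) z₀ = fderiv ℝ (fderiv ℝ f) z₀ ∧
      ∀ a b c, fderiv ℝ (fderiv ℝ (fderiv ℝ (f + cubic T z₀))) z₀ a b c =
        fderiv ℝ (fderiv ℝ (fderiv ℝ f)) z₀ a b c + T a b c := by
  have hΦ : ∀ᶠ z in 𝓝 z₀, ContDiffAt ℝ ∞ (cubic T z₀) z :=
    Filter.Eventually.of_forall fun z => contDiff_cubic.contDiffAt
  refine ⟨by simp [cubic], ?_, ?_, fun a b c => ?_⟩
  · rw [(fderiv_add_eventuallyEq hf hΦ).eq_of_nhds, fderiv_cubic h₁ h₂]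
    simp
  · rw [(fderiv_fderiv_add_eventuallyEq hf hΦ).eq_of_nhds, fderiv_fderiv_cubic h₁ h₂]
    simp
  · have := (fderiv_fderiv_add_eventuallyEq hf hΦ).fderiv.eq_of_nhds.trans
      (fderiv_add_eventuallyEq
        (eventually_contDiffAt_fderiv (eventually_contDiffAt_fderiv hf))
        (eventually_contDiffAt_fderiv (eventually_contDiffAt_fderiv hΦ))).eq_of_nhds
    rw [this, Pi.add_apply, fderiv_fderiv_fderiv_cubic h₁ h₂]
    rfl

end Cubic

/-! ### Prolonging the system in coordinates -/

section Prolongation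

variable {n : ℕ} {s : E n × E n → E n} {F Φ : E n × E n → ℝ} {z₀ : E n × E n}

/-- The third derivative of `F`. -/
abbrev D3 (F : E n × E n → ℝ) (z : E n × E n) :
    E n × E n →L[ℝ] E n × E n →L[ℝ] E n × E n →L[ℝ] ℝ :=
  fderiv ℝ (D2 F) z

/-- The expression of `𝓛_C F - F`. -/
def homDefect (F : E n × E n → ℝ) (z : E n × E n) : ℝ := fderiv ℝ F z (0, z.2) - F z

/-- The derivative at `z` in the direction `w` of the coefficient `gammaCoeff s F u v`. -/
def gammaDeriv (s : E n × E n → E n) (F : E n × E n → ℝ) (z w : E n × E n) (u v : E n) : ℝ :=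
  D3 F z w (hlift s z u) (0, v) + D2 F z (0, (1 / 2 : ℝ) • D2 s z w (0, u)) (0, v)
    - (D3 F z w (hlift s z v) (0, u) + D2 F z (0, (1 / 2 : ℝ) • D2 s z w (0, v)) (0, u))

lemma SmoothNear.D2_comm {G : Type*} [NormedAddCommGroup G] [NormedSpace ℝ G]
    {f : E n × E n → G} (hf : SmoothNear f z₀) :
    ∀ᶠ z in 𝓝 z₀, ∀ a b, D2 f z a b = D2 f z b a := by
  filter_upwards [hf] with z h a b
  exact (h.isSymmSndFDerivAt (by
    rw [minSmoothness_of_isRCLikeNormedField]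
    exact WithTop.coe_le_coe.2 le_top)).eq a b

lemma SmoothNear.D3_comm_left (hF : SmoothNear F z₀) (a b c : E n × E n) :
    D3 F z₀ a b c = D3 F z₀ b a c :=
  DFunLike.congr_fun (hF.fderiv.D2_comm.self_of_nhds a b) c

lemma SmoothNear.D3_comm_right (hF : SmoothNear F z₀) (a b c : E n × E n) :
    D3 F z₀ a b c = D3 F z₀ a c b := by
  have h := hF.fderiv.fderiv.hasFDerivAt.self_of_nhds
  -- The last two arguments commute because the symmetry of D²F holds near the point and can be
  -- differentiated.
  have happ (b c : E n × E n) : HasFDerivAt (fun z => D2 F z b c)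
      (((D3 F z₀).flip b).flip c) z₀ := by
    have := (h.clm_apply (hasFDerivAt_const b z₀)).clm_apply (hasFDerivAt_const c z₀)
    convert! this using 1
    ext <;> simp
  have heq : (fun z => D2 F z b c) =ᶠ[𝓝 z₀] fun z => D2 F z c b := by
    filter_upwards [hF.D2_comm] with z hz using hz b c
  exact DFunLike.congr_fun ((happ b c).unique ((happ c b).congr_of_eventuallyEq heq)) a

/-- By the Leibniz rule, derivatives of the arguments contribute only values of `gammaCoeff` itself.
These vanish once the undifferentiated equation holds at the point. -/
lemma fderiv_gammaCoeff (hs : SmoothNear s z₀) (hF : SmoothNear F z₀)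
    {a b : E n × E n → E n × E n} {a' b' : E n × E n →L[ℝ] E n × E n}
    (ha : HasFDerivAt a a' z₀) (hb : HasFDerivAt b b' z₀) (w : E n × E n) :
    fderiv ℝ (fun z => gammaCoeff s F (a z).1 (b z).1 z) z₀ w =
      gammaDeriv s F z₀ w (a z₀).1 (b z₀).1 + gammaCoeff s F (a' w).1 (b z₀).1 z₀
        + gammaCoeff s F (a z₀).1 (b' w).1 z₀ := by
  have h2 := hF.fderiv.fderiv.hasFDerivAt.self_of_nhds
  have hs1 := hs.fderiv.hasFDerivAt.self_of_nhds
  have hh {a : E n × E n → E n × E n} {a' : E n × E n →L[ℝ] E n × E n}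
      (ha : HasFDerivAt a a' z₀) :
      HasFDerivAt (fun z => hlift s z (a z).1) (fderiv ℝ (fun z => hlift s z (a z).1) z₀) z₀ := by
    have h := ha.fst.prodMk ((hs1.clm_apply (hasFDerivAt_vertical ha)).const_smul (1 / 2 : ℝ))
    exact (DifferentiableAt.hasFDerivAt (f := fun z => hlift s z (a z).1) h.differentiableAt)
  have key := ((h2.clm_apply (hh ha)).clm_apply (hasFDerivAt_vertical hb)).sub
    ((h2.clm_apply (hh hb)).clm_apply (hasFDerivAt_vertical ha))
  have key' : HasFDerivAt (fun z => gammaCoeff s F (a z).1 (b z).1 z) _ z₀ := key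
  rw [key'.fderiv]
  have hsplit (c : E n × E n → E n × E n) (u : E n) :
      (u, (1 / 2 : ℝ) • (D2 s z₀ w (0, (c z₀).1) + fderiv ℝ s z₀ (0, u))) =
      (0, (1 / 2 : ℝ) • D2 s z₀ w (0, (c z₀).1)) + hlift s z₀ u := by
    simp [hlift]
  have ea := (hasFDerivAt_hlift hs1 ha w).trans (hsplit a _)
  have eb := (hasFDerivAt_hlift hs1 hb w).trans (hsplit b _)
  simp [ea, eb, gammaDeriv, gammaCoeff]
  ring

lemma fderiv_homDefect (hF : SmoothNear F z₀) :
    ∀ᶠ z in 𝓝 z₀, ∀ w, fderiv ℝ (homDefect F) z w =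
      D2 F z w (0, z.2) + fderiv ℝ F z (0, w.2) - fderiv ℝ F z w := by
  filter_upwards [hF.hasFDerivAt, hF.fderiv.hasFDerivAt] with z h0 h1 w
  have hz : HasFDerivAt (fun z : E n × E n => ((0 : E n), z.2))
      ((0 : E n × E n →L[ℝ] E n).prod (ContinuousLinearMap.snd ℝ (E n) (E n))) z :=
    (hasFDerivAt_const _ _).prodMk hasFDerivAt_snd
  have key : HasFDerivAt (homDefect F) _ z := (h1.clm_apply hz).sub h0
  rw [key.fderiv]
  simp [add_comm]

lemma SmoothNear.homDefect (hF : SmoothNear F z₀) : SmoothNear (homDefect F) z₀ := by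
  filter_upwards [hF, hF.fderiv] with z h0 h1
  exact (h1.clm_apply (contDiffAt_const.prodMk contDiffAt_snd)).sub h0

lemma D2_homDefect (hF : SmoothNear F z₀) (a b : E n × E n) :
    D2 (homDefect F) z₀ a b = D3 F z₀ a b (0, z₀.2) + D2 F z₀ b (0, a.2)
      + D2 F z₀ a (0, b.2) - D2 F z₀ a b := by
  have h1 := hF.fderiv.hasFDerivAt.self_of_nhds
  have h2 := hF.fderiv.fderiv.hasFDerivAt.self_of_nhds
  have hz : HasFDerivAt (fun z : E n × E n => ((0 : E n), z.2))
      ((0 : E n × E n →L[ℝ] E n).prod (ContinuousLinearMap.snd ℝ (E n) (E n))) z₀ :=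
    (hasFDerivAt_const _ _).prodMk hasFDerivAt_snd
  have key := (((h2.clm_apply (hasFDerivAt_const b z₀)).clm_apply hz).add
    (h1.clm_apply (hasFDerivAt_const ((0 : E n), b.2) z₀))).sub
    (h1.clm_apply (hasFDerivAt_const b z₀))
  have hleft := hF.homDefect.fderiv.hasFDerivAt.self_of_nhds.clm_apply (hasFDerivAt_const b z₀)
  have heq : (fun z => fderiv ℝ (Rapcsak.homDefect F) z b) =ᶠ[𝓝 z₀] _ :=
    (fderiv_homDefect hF).mono fun z hz => hz b
  have := DFunLike.congr_fun (hleft.unique (key.congr_of_eventuallyEq heq)) a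
  simp at this
  rw [this]
  ring

/-- The equation `[C, S] = S` for the spray `(y, s)`, differentiated along the fibres. -/
lemma D2_of_homogeneous (hs : SmoothNear s z₀)
    (hhom : ∀ᶠ z in 𝓝 z₀, fderiv ℝ s z (0, z.2) = (2 : ℝ) • s z) (u : E n) :
    D2 s z₀ (0, z₀.2) (0, u) = fderiv ℝ s z₀ (0, u) := by
  have h0 := hs.hasFDerivAt.self_of_nhds
  have h1 := hs.fderiv.hasFDerivAt.self_of_nhds
  have hz : HasFDerivAt (fun z : E n × E n => ((0 : E n), z.2))
      ((0 : E n × E n →L[ℝ] E n).prod (ContinuousLinearMap.snd ℝ (E n) (E n))) z₀ :=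
    (hasFDerivAt_const _ _).prodMk hasFDerivAt_snd
  have heq : (fun z => fderiv ℝ s z (0, z.2)) =ᶠ[𝓝 z₀] fun z => (2 : ℝ) • s z := hhom
  have := DFunLike.congr_fun ((h1.clm_apply hz).unique
    ((h0.const_smul (2 : ℝ)).congr_of_eventuallyEq heq)) ((0 : E n), u)
  simp [two_smul] at this
  rw [hs.D2_comm.self_of_nhds]
  exact this

lemma gammaDeriv_antisymm (w : E n × E n) (u v : E n) :
    gammaDeriv s F z₀ w u v = -gammaDeriv s F z₀ w v u := by
  simp only [gammaDeriv]; ring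

/-- Symmetry of D³F and of D²s makes all terms cancel in pairs: vertical derivatives create no
obstruction. -/
lemma gammaDeriv_vertical_cyclic (hs : SmoothNear s z₀) (hF : SmoothNear F z₀) (u v w : E n) :
    gammaDeriv s F z₀ (0, w) u v + gammaDeriv s F z₀ (0, u) v w
      + gammaDeriv s F z₀ (0, v) w u = 0 := by
  have h2 := hs.D2_comm.self_of_nhds
  have hc (a b c : E n) : D3 F z₀ (0, a) (hlift s z₀ b) (0, c) =
      D3 F z₀ (0, c) (hlift s z₀ b) (0, a) := by
    rw [hF.D3_comm_left, hF.D3_comm_right, hF.D3_comm_left]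
  simp only [gammaDeriv, h2 (0, w) (0, u), h2 (0, v) (0, w), h2 (0, u) (0, v), hc w u v,
    hc u v w, hc v w u]
  ring

/-- The D³F terms cancel by symmetry in the two horizontal arguments. The remaining differences of
derivatives of s along horizontal lifts are the curvature coefficients. -/
lemma gammaDeriv_horizontal_cyclic (hF : SmoothNear F z₀) (u v w : E n) :
    gammaDeriv s F z₀ (hlift s z₀ w) u v + gammaDeriv s F z₀ (hlift s z₀ u) v w
      + gammaDeriv s F z₀ (hlift s z₀ v) w u = obstruction s F z₀ u v w := by
  have hv (a b : E n) : ((0 : E n), (1 / 2 : ℝ) • (a - b)) =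
      (0, (1 / 2 : ℝ) • a) - (0, (1 / 2 : ℝ) • b) := by simp [smul_sub]
  simp only [gammaDeriv, obstruction, curvCoeff, hv, map_sub, sub_apply,
    hF.D3_comm_left (hlift s z₀ w) (hlift s z₀ u),
    hF.D3_comm_left (hlift s z₀ u) (hlift s z₀ v),
    hF.D3_comm_left (hlift s z₀ v) (hlift s z₀ w)]
  ring

/-- The right side is `gammaCoeff` of `homDefect F`. Since the connection is homogeneous of degree
one, differentiating P_Γ F along C amounts to applying P_Γ to P_C F, so the two prescriptions on T
agree where they overlap. -/
lemma gammaDeriv_liouville (hs : SmoothNear s z₀) (hF : SmoothNear F z₀)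
    (hhom : ∀ᶠ z in 𝓝 z₀, fderiv ℝ s z (0, z.2) = (2 : ℝ) • s z) (u v : E n) :
    gammaDeriv s F z₀ (0, z₀.2) u v =
      D2 (homDefect F) z₀ (hlift s z₀ u) (0, v) - D2 (homDefect F) z₀ (hlift s z₀ v) (0, u) := by
  have hc (a b : E n × E n) : D3 F z₀ (0, z₀.2) a b = D3 F z₀ a b (0, z₀.2) := by
    rw [hF.D3_comm_left, hF.D3_comm_right]
  have hh (u : E n) : ((0 : E n), (1 / 2 : ℝ) • fderiv ℝ s z₀ (0, u)) = (0, (hlift s z₀ u).2) := rfl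
  simp only [gammaDeriv, D2_homDefect hF, D2_of_homogeneous hs hhom, hc, hh,
    hF.D2_comm.self_of_nhds (0, v) (0, (hlift s z₀ u).2),
    hF.D2_comm.self_of_nhds (0, u) (0, (hlift s z₀ v).2)]
  ring

lemma SmoothNear.add {G : Type*} [NormedAddCommGroup G] [NormedSpace ℝ G]
    {f g : E n × E n → G} (hf : SmoothNear f z₀) (hg : SmoothNear g z₀) :
    SmoothNear (f + g) z₀ := by
  filter_upwards [hf, hg] with z h h' using h.add h'

/-- Two functions have the same `2`-jet at `z₀`. -/
structure SameJet2 (F F' : E n × E n → ℝ) (z₀ : E n × E n) : Prop where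
  apply_eq : F z₀ = F' z₀
  fderiv_eq : fderiv ℝ F z₀ = fderiv ℝ F' z₀
  D2_eq : D2 F z₀ = D2 F' z₀

/-- Adding a suitable cubic polynomial makes the first derivatives of `P_Γ F` and the second
derivatives of `P_C F` vanish at `z₀`, provided that the obstruction vanishes. -/
lemma exists_prolongation (hs : SmoothNear s z₀) (hF : SmoothNear F z₀) (hz : z₀.2 ≠ 0)
    (hhom : ∀ᶠ z in 𝓝 z₀, fderiv ℝ s z (0, z.2) = (2 : ℝ) • s z)
    (hobs : ∀ u v w, obstruction s F z₀ u v w = 0) :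
    ∃ F', SmoothNear F' z₀ ∧ SameJet2 F' F z₀ ∧ (∀ w u v, gammaDeriv s F' z₀ w u v = 0) ∧
      D2 (homDefect F') z₀ = 0 := by
  have hl₁ (a b : E n) : ((0 : E n), a + b) = (0, a) + (0, b) := by simp
  have hl₂ (c : ℝ) (a : E n) : ((0 : E n), c • a) = c • (0, a) := by simp
  let σ : E n →ₗ[ℝ] E n := (1 / 2 : ℝ) • (fderiv ℝ s z₀).toLinearMap ∘ₗ LinearMap.inr ℝ _ _
  have hσ (u : E n) : hlift s z₀ u = (u, σ u) := rfl
  have hh₁ (a b : E n) : hlift s z₀ (a + b) = hlift s z₀ a + hlift s z₀ b := by simp [hσ]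
  have hh₂ (c : ℝ) (a : E n) : hlift s z₀ (c • a) = c • hlift s z₀ a := by simp [hσ]
  -- `B` and `Q` are the negatives of the present defects, which the third derivative of the cubic
  -- has to cancel.
  obtain ⟨B, hB⟩ := exists_trilinear_eq (fun w u v => -gammaDeriv s F z₀ w u v)
    (fun u v => ⟨fun _ _ => by
        simp only [gammaDeriv, map_add, add_apply, smul_add, hl₁]; ring,
      fun _ _ => by
        simp only [gammaDeriv, map_smul, smul_apply, hl₂, smul_eq_mul]; ring⟩)
    (fun w v => ⟨fun _ _ => by
        simp only [gammaDeriv, map_add, add_apply, smul_add, hl₁, hh₁]; ring,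
      fun _ _ => by
        simp only [gammaDeriv, map_smul, smul_apply, hl₂, hh₂, smul_eq_mul]; ring⟩)
    (fun w u => ⟨fun _ _ => by
        simp only [gammaDeriv, map_add, add_apply, smul_add, hl₁, hh₁]; ring,
      fun _ _ => by
        simp only [gammaDeriv, map_smul, smul_apply, hl₂, hh₂, smul_eq_mul]; ring⟩)
  let Q : E n × E n →ₗ[ℝ] E n × E n →ₗ[ℝ] ℝ :=
    LinearMap.mk₂ ℝ (fun a b => -D2 (homDefect F) z₀ a b)
      (fun _ _ _ => by simp; ring) (fun _ _ _ => by simp)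
      (fun _ _ _ => by simp; ring) (fun _ _ _ => by simp)
  have hQ (a b : E n × E n) : Q a b = -D2 (homDefect F) z₀ a b := rfl
  obtain ⟨T₀, hT₁, hT₂, hTB, hTQ⟩ := exists_symm_trilinear hz σ B
    (fun w u v => by rw [hB, hB, gammaDeriv_antisymm])
    (fun u v w => by
      rw [hB, hB, hB]
      linarith [gammaDeriv_vertical_cyclic hs hF u v w])
    (fun u v w => by
      rw [hB, hB, hB, ← hσ, ← hσ, ← hσ]
      linarith [gammaDeriv_horizontal_cyclic (s := s) hF u v w, hobs u v w])
    Q (fun a b => by rw [hQ, hQ, hF.homDefect.D2_comm.self_of_nhds])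
    (fun u v => by
      rw [hB, hQ, hQ, ← hσ, ← hσ, gammaDeriv_liouville hs hF hhom]
      ring)
  obtain ⟨T, hT⟩ := exists_continuous_trilinear_eq T₀
  simp only [← hT, hB, hQ, ← hσ] at hT₁ hT₂ hTB hTQ
  have hΦ : SmoothNear (cubic T z₀) z₀ :=
    Filter.Eventually.of_forall fun z => contDiff_cubic.contDiffAt
  obtain ⟨e0, e1, e2, e3⟩ := derivatives_add_cubic hF hT₁ hT₂
  refine ⟨F + cubic T z₀, hF.add hΦ, ⟨e0, e1, e2⟩, fun w u v => ?_, ?_⟩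
  · have := hTB w u v
    simp only [gammaDeriv] at this
    simp only [gammaDeriv, D2, D3, e2, e3]
    simp only [D2, D3] at this
    linarith
  · refine ContinuousLinearMap.ext fun a => ContinuousLinearMap.ext fun b => ?_
    have := hTQ a b
    rw [D2_homDefect hF] at this
    rw [D2_homDefect (hF.add hΦ), D2, D3, e2, e3]
    simp only [zero_apply]
    linarith

lemma SameJet2.gammaCoeff_eq {F F' : E n × E n → ℝ} (h : SameJet2 F F' z₀) (u v : E n) :
    gammaCoeff s F u v z₀ = gammaCoeff s F' u v z₀ := by
  simp only [gammaCoeff, h.D2_eq]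

lemma SameJet2.obstruction_eq {F F' : E n × E n → ℝ} (h : SameJet2 F F' z₀) (u v w : E n) :
    obstruction s F z₀ u v w = obstruction s F' z₀ u v w := by
  simp only [obstruction, h.D2_eq]

lemma SameJet2.homDefect_eq {F F' : E n × E n → ℝ} (h : SameJet2 F F' z₀) :
    homDefect F z₀ = homDefect F' z₀ := by
  simp only [homDefect, h.apply_eq, h.fderiv_eq]

lemma SameJet2.fderiv_homDefect_eq {F F' : E n × E n → ℝ} (h : SameJet2 F F' z₀)
    (hF : SmoothNear F z₀) (hF' : SmoothNear F' z₀) :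
    fderiv ℝ (homDefect F) z₀ = fderiv ℝ (homDefect F') z₀ := by
  refine ContinuousLinearMap.ext fun w => ?_
  rw [(fderiv_homDefect hF).self_of_nhds, (fderiv_homDefect hF').self_of_nhds, h.D2_eq,
    h.fderiv_eq]

end Prolongation


/-! ### Equality of jets through iterated derivatives -/

section Jets

variable {V : Type*} [NormedAddCommGroup V] [NormedSpace ℝ V] {f g : V → ℝ} {z : V}

lemma iteratedFDeriv_zero_eq_iff :
    iteratedFDeriv ℝ 0 f z = iteratedFDeriv ℝ 0 g z ↔ f z = g z := by
  refine ⟨fun h => ?_, fun h => ?_⟩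
  · simpa using DFunLike.congr_fun h 0
  · ext m
    simpa using h

lemma iteratedFDeriv_one_eq_iff :
    iteratedFDeriv ℝ 1 f z = iteratedFDeriv ℝ 1 g z ↔ fderiv ℝ f z = fderiv ℝ g z := by
  refine ⟨fun h => ContinuousLinearMap.ext fun w => ?_, fun h => ?_⟩
  · simpa using DFunLike.congr_fun h fun _ => w
  · ext m
    simp [h]

lemma iteratedFDeriv_two_eq_iff :
    iteratedFDeriv ℝ 2 f z = iteratedFDeriv ℝ 2 g z ↔
      fderiv ℝ (fderiv ℝ f) z = fderiv ℝ (fderiv ℝ g) z := by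
  refine ⟨fun h => ContinuousLinearMap.ext fun a => ContinuousLinearMap.ext fun b => ?_,
    fun h => ?_⟩
  · simpa [iteratedFDeriv_two_apply] using DFunLike.congr_fun h ![a, b]
  · ext m
    simp [iteratedFDeriv_two_apply, h]

end Jets

/-! ### Formal solutions and the obstruction in coordinates -/

section FormalSolutions

variable {n : ℕ} {M : Type*} [TopologicalSpace M] [ChartedSpace (E n) M]
  [IsManifold (𝓡 n) ∞ M]

variable {x : TM n M} {S : VField n M} {F F' : TM n M → ℝ} {Fc Fc' : E n × E n → ℝ}
  {s : E n × E n → E n}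

lemma RepFn.jet_two_eq_iff (hF : RepFn x F Fc) (hF' : RepFn x F' Fc') :
    jet 2 F x = jet 2 F' x ↔ SameJet2 Fc Fc' (chart x x) := by
  rw [hF.jet_eq, hF'.jet_eq, funext_iff]
  refine ⟨fun h => ⟨iteratedFDeriv_zero_eq_iff.1 (h 0), iteratedFDeriv_one_eq_iff.1 (h 1),
    iteratedFDeriv_two_eq_iff.1 (h 2)⟩, fun h i => ?_⟩
  fin_cases i
  · exact iteratedFDeriv_zero_eq_iff.2 h.apply_eq
  · exact iteratedFDeriv_one_eq_iff.2 h.fderiv_eq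
  · exact iteratedFDeriv_two_eq_iff.2 h.D2_eq

lemma repFn_zero (x : TM n M) : RepFn x (0 : TM n M → ℝ) 0 :=
  ⟨Filter.Eventually.of_forall fun _ => contDiffAt_const, Filter.Eventually.of_forall fun _ => rfl⟩

lemma jet_zero (k : ℕ) (x : TM n M) : jet k (0 : TM n M → ℝ) x = 0 := by
  rw [(repFn_zero x).jet_eq]
  funext i
  simp

lemma RepFn.jet_zero_eq_zero_iff (hF : RepFn x F Fc) :
    jet 0 F x = 0 ↔ Fc (chart x x) = 0 := by
  rw [← jet_zero 0 x, hF.jet_eq, (repFn_zero x).jet_eq, funext_iff]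
  refine ⟨fun h => iteratedFDeriv_zero_eq_iff.1 (h 0), fun h i => ?_⟩
  fin_cases i
  exact iteratedFDeriv_zero_eq_iff.2 h

lemma RepFn.jet_one_eq_zero_iff (hF : RepFn x F Fc) :
    jet 1 F x = 0 ↔ Fc (chart x x) = 0 ∧ fderiv ℝ Fc (chart x x) = 0 := by
  have h0 : fderiv ℝ (0 : E n × E n → ℝ) (chart x x) = 0 := by simp
  rw [← jet_zero 1 x, hF.jet_eq, (repFn_zero x).jet_eq, funext_iff]
  refine ⟨fun h => ⟨iteratedFDeriv_zero_eq_iff.1 (h 0),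
    (iteratedFDeriv_one_eq_iff.1 (h 1)).trans h0⟩, fun h i => ?_⟩
  fin_cases i
  · exact iteratedFDeriv_zero_eq_iff.2 h.1
  · exact iteratedFDeriv_one_eq_iff.2 (h.2.trans h0.symm)

lemma RepFn.jet_two_eq_zero_iff (hF : RepFn x F Fc) :
    jet 2 F x = 0 ↔ Fc (chart x x) = 0 ∧ fderiv ℝ Fc (chart x x) = 0 ∧
      D2 Fc (chart x x) = 0 := by
  have h1 : fderiv ℝ (0 : E n × E n → ℝ) = 0 := by funext z; simp
  have h2 : D2 (0 : E n × E n → ℝ) (chart x x) = 0 := by rw [D2, h1]; simp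
  rw [← jet_zero 2 x, hF.jet_two_eq_iff (repFn_zero x)]
  refine ⟨fun h => ⟨h.apply_eq, h.fderiv_eq.trans (by simp), h.D2_eq.trans h2⟩,
    fun h => ⟨h.1, h.2.1.trans (by simp), h.2.2.trans h2.symm⟩⟩

/-- Constant fields suffice as test fields, since the coefficients of P_Γ F and i_R dd_J F see only
horizontal components. -/
lemma exists_rep_horizontal (x : TM n M) (u : E n) :
    ∃ X : VField n M, SmoothVFNear X x ∧ Rep x X (fun _ => (u, 0)) :=
  exists_rep_of_coord x (Filter.Eventually.of_forall fun _ => contDiffAt_const)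

lemma jetVanishes_zero_PGamma_iff (hS : Rep x S (fun z => (z.2, s z)))
    (hs : SmoothNear s (chart x x)) (hF : RepFn x F Fc) :
    jetVanishes 0 (PGamma S F) x ↔ ∀ u v, gammaCoeff s Fc u v (chart x x) = 0 := by
  refine ⟨fun h u v => ?_, fun h X Y hX hY => ?_⟩
  · obtain ⟨X, hX, hXc⟩ := exists_rep_horizontal x u
    obtain ⟨Y, hY, hYc⟩ := exists_rep_horizontal x v
    have := (hF.PGamma hS hs hXc hYc).jet_zero_eq_zero_iff.1 (h X Y hX hY)
    simpa using this
  · obtain ⟨Xc, hXc⟩ := exists_rep hX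
    obtain ⟨Yc, hYc⟩ := exists_rep hY
    rw [(hF.PGamma hS hs hXc hYc).jet_zero_eq_zero_iff, h, mul_zero]

lemma jetVanishes_one_PGamma_iff (hS : Rep x S (fun z => (z.2, s z)))
    (hs : SmoothNear s (chart x x)) (hF : RepFn x F Fc) :
    jetVanishes 1 (PGamma S F) x ↔ (∀ u v, gammaCoeff s Fc u v (chart x x) = 0) ∧
      ∀ w u v, gammaDeriv s Fc (chart x x) w u v = 0 := by
  -- With the coefficients zero at the point, the derivative depends on X and Y only through their
  -- values there, so arbitrary fields reduce to constant ones.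
  have hderiv {Xc Yc : E n × E n → E n × E n} (hX : SmoothNear Xc (chart x x))
      (hY : SmoothNear Yc (chart x x)) (h : ∀ u v, gammaCoeff s Fc u v (chart x x) = 0)
      (w : E n × E n) : fderiv ℝ (fun z => 2 * gammaCoeff s Fc (Xc z).1 (Yc z).1 z) (chart x x) w =
        2 * gammaDeriv s Fc (chart x x) w (Xc (chart x x)).1 (Yc (chart x x)).1 := by
    have e := congrFun (fderiv_const_smul_field (𝕜 := ℝ) (2 : ℝ)
      (f := fun z => gammaCoeff s Fc (Xc z).1 (Yc z).1 z)) (chart x x)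
    have e' := DFunLike.congr_fun e w
    rw [Pi.smul_apply, smul_apply, fderiv_gammaCoeff hs hF.1 hX.hasFDerivAt.self_of_nhds
      hY.hasFDerivAt.self_of_nhds, h, h, add_zero, add_zero] at e'
    exact e'
  refine ⟨fun h => ?_, fun h X Y hX hY => ?_⟩
  · have h0 (u v : E n) : gammaCoeff s Fc u v (chart x x) = 0 := by
      obtain ⟨X, hX, hXc⟩ := exists_rep_horizontal x u
      obtain ⟨Y, hY, hYc⟩ := exists_rep_horizontal x v
      have := ((hF.PGamma hS hs hXc hYc).jet_one_eq_zero_iff.1 (h X Y hX hY)).1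
      simpa using this
    refine ⟨h0, fun w u v => ?_⟩
    obtain ⟨X, hX, hXc⟩ := exists_rep_horizontal x u
    obtain ⟨Y, hY, hYc⟩ := exists_rep_horizontal x v
    have := ((hF.PGamma hS hs hXc hYc).jet_one_eq_zero_iff.1 (h X Y hX hY)).2
    have hw := hderiv hXc.1 hYc.1 h0 w
    rw [this, zero_apply] at hw
    simpa using hw.symm
  · obtain ⟨Xc, hXc⟩ := exists_rep hX
    obtain ⟨Yc, hYc⟩ := exists_rep hY
    rw [(hF.PGamma hS hs hXc hYc).jet_one_eq_zero_iff, h.1, mul_zero]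
    refine ⟨rfl, ContinuousLinearMap.ext fun w => ?_⟩
    rw [hderiv hXc.1 hYc.1 h.1 w, h.2, mul_zero, zero_apply]

lemma vanishesAt_ins2_curvature_iff (hS : Rep x S (fun z => (z.2, s z)))
    (hs : SmoothNear s (chart x x)) (hF : RepFn x F Fc) :
    vanishesAt (ins2 (curvature S) (ddJ F)) x ↔
      ∀ u v w, obstruction s Fc (chart x x) u v w = 0 := by
  refine ⟨fun h u v w => ?_, fun h X Y Z hX hY hZ => ?_⟩
  · obtain ⟨X, hX, hXc⟩ := exists_rep_horizontal x u
    obtain ⟨Y, hY, hYc⟩ := exists_rep_horizontal x v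
    obtain ⟨Z, hZ, hZc⟩ := exists_rep_horizontal x w
    exact (hF.ins2_curvature hS hs hXc hYc hZc).eq_apply.symm.trans (h X Y Z hX hY hZ)
  · obtain ⟨Xc, hXc⟩ := exists_rep hX
    obtain ⟨Yc, hYc⟩ := exists_rep hY
    obtain ⟨Zc, hZc⟩ := exists_rep hZ
    exact (hF.ins2_curvature hS hs hXc hYc hZc).eq_apply.trans (h _ _ _)

end FormalSolutions

end Rapcsak
end

theorem mainTheorem5 {n : ℕ} {M : Type*} [TopologicalSpace M]
    [ChartedSpace (EuclideanSpace ℝ (Fin n)) M] [IsManifold (𝓡 n) ∞ M]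
    (S : Rapcsak.VField n M) (hS : Rapcsak.IsSpray S)
    (x : TangentBundle (𝓡 n) M) (hx : x ∈ Rapcsak.slit n M)
    (F : TangentBundle (𝓡 n) M → ℝ) (hF : Rapcsak.SmoothFnNear F x)
    (hsol : Rapcsak.jet 2 F x ∈ Rapcsak.Sol S 0 x) :
    (∃ s ∈ Rapcsak.Sol S 1 x, Rapcsak.jetProj s = Rapcsak.jet 2 F x) ↔
      Rapcsak.vanishesAt (Rapcsak.ins2 (Rapcsak.curvature S) (Rapcsak.ddJ F)) x := by
  open Rapcsak in
  obtain ⟨s, hs, hSc, hhom⟩ := hS.exists_rep hx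
  obtain ⟨Fc, hFc⟩ := exists_repFn hF
  rw [vanishesAt_ins2_curvature_iff hSc hs hFc]
  constructor
  -- Necessity uses only the P_Γ half of the system.
  · rintro ⟨_, ⟨F', hF', rfl, hΓ, -⟩, hproj⟩ u v w
    obtain ⟨Fc', hFc'⟩ := exists_repFn hF'
    have hjet : SameJet2 Fc' Fc (chart x x) := (hFc'.jet_two_eq_iff hFc).1 hproj
    have hd := ((jetVanishes_one_PGamma_iff hSc hs hFc').1 hΓ).2
    rw [← hjet.obstruction_eq, ← gammaDeriv_horizontal_cyclic hFc'.1, hd, hd, hd]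
    simp
  · intro hobs
    -- The function witnessing the second-order solution may differ from `F`. It is the one to be
    -- corrected, and the obstruction transfers to it because it depends only on the 2-jet.
    obtain ⟨F₀, hF₀, hjet₀, hΓ₀, hC₀⟩ := hsol
    obtain ⟨Fc₀, hFc₀⟩ := exists_repFn hF₀
    have hsame₀ : SameJet2 Fc₀ Fc (chart x x) := (hFc₀.jet_two_eq_iff hFc).1 hjet₀
    rw [jetVanishes_zero_PGamma_iff hSc hs hFc₀] at hΓ₀
    obtain ⟨hC₀, hC₁⟩ := hFc₀.PC.jet_one_eq_zero_iff.1 hC₀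
    obtain ⟨Fc', hsm, hsame, hΓ', hC'⟩ := exists_prolongation hs hFc₀.1
      ((chart_snd_ne_zero_iff (mem_extChartAt_source x)).2 hx) hhom
      fun u v w => (hsame₀.obstruction_eq u v w).trans (hobs u v w)
    obtain ⟨F', hF'⟩ := exists_repFn_of_coord x hsm
    refine ⟨jet 3 F' x, ⟨F', smoothFnNear_of_repFn hF', rfl, ?_, ?_⟩, ?_⟩
    · exact (jetVanishes_one_PGamma_iff hSc hs hF').2
        ⟨fun u v => (hsame.gammaCoeff_eq u v).trans (hΓ₀ u v), hΓ'⟩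
    · exact hF'.PC.jet_two_eq_zero_iff.2 ⟨hsame.homDefect_eq.trans hC₀,
        (hsame.fderiv_homDefect_eq hsm hFc₀.1).trans hC₁, hC'⟩
    · exact ((hF'.jet_two_eq_iff hFc₀).2 hsame).trans hjet₀
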